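/- Let $A_1=\mathfrak{sl}(2,\mathbb C)$ and $A_2=\mathfrak{sl}(3,\mathbb C)$. Let $h_1,h_2,x_1,x_2,x_3,y_1,y_2,y_3$ be the Chevalley basis of $A_2$ determined by $$a h_1+b h_2+c x_1+d x_2+e x_3+c' y_1+d' y_2+e' y_3=\begin{pmatrix} a & c & -e\\ c' & b-a & d\\ -e' & d' & -b\end{pmatrix},$$ and write $\langle W_1,\dots,W_m\rangle$ for the subalgebra of $A_2$ generated by $W_1,\dots,W_m$. A Lie algebra is called Levi decomposable if it is the semidirect (possibly direct) sum $\mathfrak s\ltimes\mathfrak r$ of a nonzero semisimple subalgebra $\mathfrak s$ and a nonzero solvable ideal $\mathfrak r$. Two subalgebras $L,L'$ of $A_2$ are equivalent up to inner automorphism if $A^{-1}LA=L'$ for some $A\in SL(3,\mathbb C)$. Let $J$ and $K_1$ be the abelian Lie algebras over $\mathbb C$ of dimension $1$ and $2$ ($K_1$ with basis $z_1,z_2$), and let $L_2$ be the Lie algebra with basis $z_1,z_2,z_3$, $[z_3,z_1]=z_1$, $[z_3,z_2]=z_2$, $[z_1,z_2]=0$. Let $\chi:A_1\to A_2$ be the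 embedding $E_{12}\mapsto x_3$, $E_{21}\mapsto y_3$, $E_{11}-E_{22}\mapsto h_1+h_2$. Let $\psi_1:K_1\to A_2$ be $z_1\mapsto x_1$, $z_2\mapsto y_2$, and let $\psi_2:L_2\to A_2$ be $z_1\mapsto x_1$, $z_2\mapsto y_2$, $z_3\mapsto\frac13(h_1-h_2)$. Define $\varphi_1:A_1\to \mathrm{Der}(K_1)$ and $\varphi_2:A_1\to\mathrm{Der}(L_2)$ by $\varphi_i(M)(z)=\psi_i^{-1}([\chi(M),\psi_i(z)])$. **Theorem.** Put $A_1^1=\langle x_3,y_3,h_1+h_2\rangle$. Up to inner automorphism, $A_2$ has exactly five Levi decomposable subalgebras, namely $$\begin{aligned} A_1^1\oplus\langle h_1-h_2\rangle&\cong A_1\oplus J\;(\cong\mathfrak{gl}(2,\mathbb C)),\\ A_1^1\ltimes\langle x_1,y_2\rangle&\cong A_1\ltimes_{\varphi_1}K_1,\\ A_1^1\ltimes\langle x_2,y_1\rangle&\cong A_1\ltimes_{\varphi_1}K_1,\\ A_1^1\ltimes\langle h_1-h_2,x_1,y_2\rangle&\cong A_1\ltimes_{\varphi_2}L_2,\\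 A_1^1\ltimes\langle h_1-h_2,x_2,y_1\rangle&\cong A_1\ltimes_{\varphi_2}L_2. \end{aligned}$$ That is: each of these five is a Levi decomposable subalgebra of $A_2$, with the displayed (semi)direct sum decomposition and isomorphism; every Levi decomposable subalgebra of $A_2$ is equivalent to one of them; and no two of them are equivalent. The second and third have dimension $5$, the last two dimension $6$. Moreover, no subalgebra of $A_2$ containing the principal subalgebra $A_1^2=\langle x_1+x_2,\,2y_1+2y_2,\,2h_1+2h_2\rangle$ is Levi decomposable. -/

import Mathlib

open LieAlgebra LieAlgebra.SpecialLinear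

attribute [local instance 100] LieRing.ofAssociativeRing

noncomputable section

namespace LeviA2

/-- The Lie algebra `A₁` of traceless complex `2 × 2` matrices. -/
abbrev A1 : Type := sl (Fin 2) ℂ

/-- The Lie algebra `A₂` of traceless complex `3 × 3` matrices. -/
abbrev A2 : Type := sl (Fin 3) ℂ

/-! ### Chevalley basis of `A₂` -/

theorem mem_A2 {M : Matrix (Fin 3) (Fin 3) ℂ} (h : Matrix.trace M = 0) : M ∈ sl (Fin 3) ℂ :=
  LinearMap.mem_ker.2 h

/-- The matrix `a h₁ + b h₂ + c x₁ + d x₂ + e x₃ + c' y₁ + d' y₂ + e' y₃`. -/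
def chevalley (a b c d e c' d' e' : ℂ) : A2 :=
  ⟨!![a, c, -e; c', b - a, d; -e', d', -b], 
    mem_A2 (by simp [Matrix.trace_fin_three])⟩

def h₁ : A2 := chevalley 1 0 0 0 0 0 0 0
def h₂ : A2 := chevalley 0 1 0 0 0 0 0 0
def x₁ : A2 := chevalley 0 0 1 0 0 0 0 0
def x₂ : A2 := chevalley 0 0 0 1 0 0 0 0
def x₃ : A2 := chevalley 0 0 0 0 1 0 0 0
def y₁ : A2 := chevalley 0 0 0 0 0 1 0 0
def y₂ : A2 := chevalley 0 0 0 0 0 0 1 0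
def y₃ : A2 := chevalley 0 0 0 0 0 0 0 1

theorem chevalley_eq (a b c d e c' d' e' : ℂ) :
    chevalley a b c d e c' d' e' =
      a • h₁ + b • h₂ + c • x₁ + d • x₂ + e • x₃ + c' • y₁ + d' • y₂ + e' • y₃ := by
  apply Subtype.ext
  ext i j
  fin_cases i <;> fin_cases j <;>
    simp [chevalley, h₁, h₂, x₁, x₂, x₃, y₁, y₂, y₃] <;> ring

/-- `⟨W₁, …, W_m⟩`: the subalgebra of `A₂` generated by a set. -/
abbrev gen (W : Set A2) : LieSubalgebra ℂ A2 := LieSubalgebra.lieSpan ℂ A2 W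

/-- The copy `A₁¹` of `A₁` in `A₂`. -/
def A11 : LieSubalgebra ℂ A2 := gen {x₃, y₃, h₁ + h₂}

/-- The principal copy `A₁²` of `A₁` in `A₂`. -/
def A12 : LieSubalgebra ℂ A2 :=
  gen {x₁ + x₂, (2 : ℂ) • y₁ + (2 : ℂ) • y₂, (2 : ℂ) • h₁ + (2 : ℂ) • h₂}

/-! ### Equivalence up to inner automorphism -/

/-- The inner automorphism `X ↦ A⁻¹ X A` of `A₂` given by `A ∈ SL(3, ℂ)`. -/
def innerAut (A : Matrix.SpecialLinearGroup (Fin 3) ℂ) : A2 ≃ₗ⁅ℂ⁆ A2 where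
  toFun X := ⟨(A⁻¹).val * X.val * A.val, by
    have hX : Matrix.trace X.val = 0 := X.property
    have hA : A.val * (A⁻¹).val = 1 := by
      rw [← Matrix.SpecialLinearGroup.coe_mul, mul_inv_cancel, Matrix.SpecialLinearGroup.coe_one]
    apply mem_A2
    rw [Matrix.trace_mul_comm, ← mul_assoc, hA, one_mul, hX]⟩
  invFun X := ⟨A.val * X.val * (A⁻¹).val, by
    have hX : Matrix.trace X.val = 0 := X.property
    have hA : (A⁻¹).val * A.val = 1 := by
      rw [← Matrix.SpecialLinearGroup.coe_mul, inv_mul_cancel, Matrix.SpecialLinearGroup.coe_one]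
    apply mem_A2
    rw [Matrix.trace_mul_comm, ← mul_assoc, hA, one_mul, hX]⟩
  map_add' X Y := by
    apply Subtype.ext
    simp [mul_add, add_mul]
  map_smul' c X := by
    apply Subtype.ext
    simp
  map_lie' {X Y} := by
    have hA : A.val * (A⁻¹).val = 1 := by
      rw [← Matrix.SpecialLinearGroup.coe_mul, mul_inv_cancel, Matrix.SpecialLinearGroup.coe_one]
    have key : ∀ U V : Matrix (Fin 3) (Fin 3) ℂ,
        (A⁻¹).val * (U * V) * A.val
          = ((A⁻¹).val * U * A.val) * ((A⁻¹).val * V * A.val) := by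
      intro U V
      calc (A⁻¹).val * (U * V) * A.val = (A⁻¹).val * U * 1 * V * A.val := by
            simp only [mul_one, mul_assoc]
        _ = _ := by rw [← hA]; simp only [mul_assoc]
    apply Subtype.ext
    simp only [sl_bracket]
    rw [mul_sub, sub_mul, key, key]
  left_inv X := by
    have hA : A.val * (A⁻¹).val = 1 := by
      rw [← Matrix.SpecialLinearGroup.coe_mul, mul_inv_cancel, Matrix.SpecialLinearGroup.coe_one]
    apply Subtype.ext
    change A.val * ((A⁻¹).val * X.val * A.val) * (A⁻¹).val = X.val
    rw [mul_assoc, mul_assoc ((A⁻¹).val * X.val), hA, mul_one, ← mul_assoc, hA, one_mul]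
  right_inv X := by
    have hA : (A⁻¹).val * A.val = 1 := by
      rw [← Matrix.SpecialLinearGroup.coe_mul, inv_mul_cancel, Matrix.SpecialLinearGroup.coe_one]
    apply Subtype.ext
    change (A⁻¹).val * (A.val * X.val * (A⁻¹).val) * A.val = X.val
    rw [mul_assoc, mul_assoc (A.val * X.val), hA, mul_one, ← mul_assoc, hA, one_mul]

/-- Equivalence of subalgebras of `A₂` up to inner automorphism. -/
def Equivalent (L L' : LieSubalgebra ℂ A2) : Prop :=
  ∃ A : Matrix.SpecialLinearGroup (Fin 3) ℂ, L.map (innerAut A).toLieHom = L'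

/-! ### Levi decomposable subalgebras -/

section Levi

variable {g : Type*} [LieRing g] [LieAlgebra ℂ g]

/-- `L` is the (internal) semidirect sum of its subalgebra `S` and its ideal `R`. -/
structure IsSemidirectSum (S R L : LieSubalgebra ℂ g) : Prop where
  inf_eq_bot : S.toSubmodule ⊓ R.toSubmodule = ⊥
  sup_eq : S.toSubmodule ⊔ R.toSubmodule = L.toSubmodule
  ideal : ∀ x ∈ L, ∀ y ∈ R, ⁅x, y⁆ ∈ R

/-- `L` is the (internal) direct sum of its ideals `S` and `R`. -/
structure IsDirectSum (S R L : LieSubalgebra ℂ g) : Prop extends IsSemidirectSum S R L where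
  commute : ∀ x ∈ S, ∀ y ∈ R, ⁅x, y⁆ = 0

/-- `L` is Levi decomposable: it is the semidirect (possibly direct) sum of a nonzero semisimple
subalgebra and a nonzero solvable ideal. -/
def IsLeviDecomposable (L : LieSubalgebra ℂ g) : Prop :=
  ∃ S R : LieSubalgebra ℂ g, S ≠ ⊥ ∧ R ≠ ⊥ ∧
    LieAlgebra.IsSemisimple ℂ S ∧ LieAlgebra.IsSolvable R ∧ IsSemidirectSum S R L

end Levi

/-- The radicals in the list of Levi decomposable subalgebras. -/
def radicalPart : Fin 5 → LieSubalgebra ℂ A2 :=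
  ![gen {h₁ - h₂}, gen {x₁, y₂}, gen {x₂, y₁}, gen {h₁ - h₂, x₁, y₂}, gen {h₁ - h₂, x₂, y₁}]

/-- The list of Levi decomposable subalgebras of `A₂`. -/
def leviSubalgebra (i : Fin 5) : LieSubalgebra ℂ A2 := A11 ⊔ radicalPart i

/-! ### The abstract Lie algebras `J`, `K₁`, `L₂` -/

/-- The one-dimensional abelian Lie algebra. -/
def J : Type := ℂ

instance : AddCommGroup J := inferInstanceAs (AddCommGroup ℂ)
instance : Module ℂ J := inferInstanceAs (Module ℂ ℂ)
instance : LieRing J where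
  bracket _ _ := 0
  add_lie _ _ _ := (add_zero _).symm
  lie_add _ _ _ := (add_zero _).symm
  lie_self _ := rfl
  leibniz_lie _ _ _ := (add_zero _).symm
instance : LieAlgebra ℂ J where
  lie_smul _ _ _ := (smul_zero _).symm

/-- The two-dimensional abelian Lie algebra; `u` stands for `u 0 • z₁ + u 1 • z₂`. -/
def K1 : Type := Fin 2 → ℂ

instance : AddCommGroup K1 := inferInstanceAs (AddCommGroup (Fin 2 → ℂ))
instance : Module ℂ K1 := inferInstanceAs (Module ℂ (Fin 2 → ℂ))
instance : LieRing K1 where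
  bracket _ _ := 0
  add_lie _ _ _ := (add_zero _).symm
  lie_add _ _ _ := (add_zero _).symm
  lie_self _ := rfl
  leibniz_lie _ _ _ := (add_zero _).symm
instance : LieAlgebra ℂ K1 where
  lie_smul _ _ _ := (smul_zero _).symm

/-- The Lie algebra `L₂` with basis `z₁, z₂, z₃` and `[z₃, z₁] = z₁`, `[z₃, z₂] = z₂`,
`[z₁, z₂] = 0`; `u` stands for `u 0 • z₁ + u 1 • z₂ + u 2 • z₃`. -/
def L2 : Type := Fin 3 → ℂ

instance : AddCommGroup L2 := inferInstanceAs (AddCommGroup (Fin 3 → ℂ))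
instance : Module ℂ L2 := inferInstanceAs (Module ℂ (Fin 3 → ℂ))

/-- The underlying bilinear operation of the bracket of `L₂`. -/
def bracketL2 (u v : Fin 3 → ℂ) : Fin 3 → ℂ :=
  ![u 2 * v 0 - v 2 * u 0, u 2 * v 1 - v 2 * u 1, 0]

instance : LieRing L2 where
  bracket u v := bracketL2 u v
  add_lie u v w := by
    have key : ∀ u v w : Fin 3 → ℂ, bracketL2 (u + v) w = bracketL2 u w + bracketL2 v w := by
      intro u v w; ext i; fin_cases i <;> simp [bracketL2] <;> ring
    exact key u v w
  lie_add u v w := by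
    have key : ∀ u v w : Fin 3 → ℂ, bracketL2 u (v + w) = bracketL2 u v + bracketL2 u w := by
      intro u v w; ext i; fin_cases i <;> simp [bracketL2] <;> ring
    exact key u v w
  lie_self u := by
    change bracketL2 u u = (0 : Fin 3 → ℂ)
    ext i; fin_cases i <;> simp [bracketL2]
  leibniz_lie u v w := by
    change bracketL2 u (bracketL2 v w)
      = (bracketL2 (bracketL2 u v) w + bracketL2 v (bracketL2 u w) : Fin 3 → ℂ)
    ext i; fin_cases i <;> simp [bracketL2] <;> ring
instance : LieAlgebra ℂ L2 where
  lie_smul c u v := by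
    have key : ∀ u v : Fin 3 → ℂ, bracketL2 u (c • v) = c • bracketL2 u v := by
      intro u v; ext i; fin_cases i <;> simp [bracketL2] <;> ring
    exact key u v

/-! ### The actions `φ₁` and `φ₂` -/

/-- The action of a `2 × 2` matrix on `K₁`. -/
def actK1 (M : Matrix (Fin 2) (Fin 2) ℂ) (u : Fin 2 → ℂ) : Fin 2 → ℂ :=
  ![M 0 0 * u 0 - M 0 1 * u 1, -M 1 0 * u 0 + M 1 1 * u 1]

/-- The action of a `2 × 2` matrix on `L₂`. -/
def actL2 (M : Matrix (Fin 2) (Fin 2) ℂ) (u : Fin 3 → ℂ) : Fin 3 → ℂ :=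
  ![M 0 0 * u 0 - M 0 1 * u 1, -M 1 0 * u 0 + M 1 1 * u 1, 0]

/-- `φ₁ : A₁ → Der(K₁)`; see `psi1_phi1` for its characterisation. -/
def phi1 : A1 →ₗ⁅ℂ⁆ LieDerivation ℂ K1 K1 where
  toFun M :=
    { toFun := fun u => actK1 M.val u
      map_add' := fun u v => by
        have key : ∀ u v : Fin 2 → ℂ, actK1 M.val (u + v) = actK1 M.val u + actK1 M.val v := by
          intro u v; ext i; fin_cases i <;> simp [actK1] <;> ring
        exact key u v
      map_smul' := fun c u => by
        have key : ∀ u : Fin 2 → ℂ, actK1 M.val (c • u) = c • actK1 M.val u := by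
          intro u; ext i; fin_cases i <;> simp [actK1] <;> ring
        exact key u
      leibniz' := fun u v => by
        change actK1 M.val (0 : Fin 2 → ℂ) = (0 - 0 : Fin 2 → ℂ)
        ext i; fin_cases i <;> simp [actK1] }
  map_add' M N := by
    ext u
    change actK1 (M.val + N.val) u = (actK1 M.val u + actK1 N.val u : Fin 2 → ℂ)
    ext i; fin_cases i <;> simp [actK1] <;> ring
  map_smul' c M := by
    ext u
    change actK1 (c • M.val) u = (c • actK1 M.val u : Fin 2 → ℂ)
    ext i; fin_cases i <;> simp [actK1] <;> ring
  map_lie' {M N} := by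
    ext u
    change actK1 (M.val * N.val - N.val * M.val) u
      = (actK1 M.val (actK1 N.val u) - actK1 N.val (actK1 M.val u) : Fin 2 → ℂ)
    ext i; fin_cases i <;> simp [actK1, Matrix.mul_apply, Fin.sum_univ_two] <;> ring

/-- `φ₂ : A₁ → Der(L₂)`; see `psi2_phi2` for its characterisation. -/
def phi2 : A1 →ₗ⁅ℂ⁆ LieDerivation ℂ L2 L2 where
  toFun M :=
    { toFun := fun u => actL2 M.val u
      map_add' := fun u v => by
        have key : ∀ u v : Fin 3 → ℂ, actL2 M.val (u + v) = actL2 M.val u + actL2 M.val v := by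
          intro u v; ext i; fin_cases i <;> simp [actL2] <;> ring
        exact key u v
      map_smul' := fun c u => by
        have key : ∀ u : Fin 3 → ℂ, actL2 M.val (c • u) = c • actL2 M.val u := by
          intro u; ext i; fin_cases i <;> simp [actL2] <;> ring
        exact key u
      leibniz' := fun u v => by
        change actL2 M.val (bracketL2 u v)
          = (bracketL2 u (actL2 M.val v) - bracketL2 v (actL2 M.val u) : Fin 3 → ℂ)
        ext i; fin_cases i <;> simp [actL2, bracketL2] <;> ring }
  map_add' M N := by
    ext u
    change actL2 (M.val + N.val) u = (actL2 M.val u + actL2 N.val u : Fin 3 → ℂ)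
    ext i; fin_cases i <;> simp [actL2] <;> ring
  map_smul' c M := by
    ext u
    change actL2 (c • M.val) u = (c • actL2 M.val u : Fin 3 → ℂ)
    ext i; fin_cases i <;> simp [actL2] <;> ring
  map_lie' {M N} := by
    ext u
    change actL2 (M.val * N.val - N.val * M.val) u
      = (actL2 M.val (actL2 N.val u) - actL2 N.val (actL2 M.val u) : Fin 3 → ℂ)
    ext i; fin_cases i <;> simp [actL2, Matrix.mul_apply, Fin.sum_univ_two] <;> ring

/-- The linear map `χ : A₁ → A₂`, `x ↦ x₃`, `y ↦ y₃`, `h ↦ h₁ + h₂`, for the Chevalley basis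
`x = E₁₂`, `y = E₂₁`, `h = E₁₁ - E₂₂` of `A₁`. -/
def chi (M : A1) : A2 := M.val 0 1 • x₃ + M.val 1 0 • y₃ + M.val 0 0 • (h₁ + h₂)

/-- `ψ₁ : z₁ ↦ x₁, z₂ ↦ y₂`. -/
def psi1 (u : K1) : A2 := (u : Fin 2 → ℂ) 0 • x₁ + (u : Fin 2 → ℂ) 1 • y₂

/-- `ψ₂ : z₁ ↦ x₁, z₂ ↦ y₂, z₃ ↦ (h₁ - h₂) / 3`. -/
def psi2 (u : L2) : A2 :=
  (u : Fin 3 → ℂ) 0 • x₁ + (u : Fin 3 → ℂ) 1 • y₂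
    + (u : Fin 3 → ℂ) 2 • ((1 / 3 : ℂ) • (h₁ - h₂))

/-- `φ₁(M)(z) = ψ₁⁻¹([χ(M), ψ₁(z)])`. -/
theorem psi1_phi1 (M : A1) (u : K1) : psi1 (phi1 M u) = ⁅chi M, psi1 u⁆ := by
  have hM : M.val 1 1 = - M.val 0 0 := by
    have h : Matrix.trace M.val = 0 := M.property
    rw [Matrix.trace_fin_two] at h
    linear_combination h
  have h0 : (phi1 M u : Fin 2 → ℂ) = actK1 M.val u := rfl
  apply Subtype.ext
  rw [sl_bracket]
  ext i j
  fin_cases i <;> fin_cases j <;>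
    simp [psi1, chi, h0, actK1, chevalley, h₁, h₂, x₁, x₃, y₂, y₃, hM,
      Matrix.mul_apply, Fin.sum_univ_three] <;> ring

/-- `φ₂(M)(z) = ψ₂⁻¹([χ(M), ψ₂(z)])`. -/
theorem psi2_phi2 (M : A1) (u : L2) : psi2 (phi2 M u) = ⁅chi M, psi2 u⁆ := by
  have hM : M.val 1 1 = - M.val 0 0 := by
    have h : Matrix.trace M.val = 0 := M.property
    rw [Matrix.trace_fin_two] at h
    linear_combination h
  have h0 : (phi2 M u : Fin 3 → ℂ) = actL2 M.val u := rfl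
  apply Subtype.ext
  rw [sl_bracket]
  ext i j
  fin_cases i <;> fin_cases j <;>
    simp [psi2, chi, h0, actL2, chevalley, h₁, h₂, x₁, x₃, y₂, y₃, hM,
      Matrix.mul_apply, Fin.sum_univ_three] <;> ring

end LeviA2

end

open LeviA2

/-!
A Lie algebra with a nonzero solvable ideal has no faithful irreducible traceless representation,
so a Levi decomposable `L ⊆ 𝔰𝔩(3)` leaves a line or a plane of `ℂ³` invariant. The automorphism
`X ↦ -Xᵀ` exchanges the two cases and permutes the five subalgebras of the list, so `L` may be
assumed to fix the line spanned by the second basis vector. Its stabilizer is the parabolic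
subalgebra `A₁¹ ⋉ ⟨h₁ - h₂, x₂, y₁⟩`, and a Levi factor of `L` maps isomorphically onto the
`A₁`-quotient of it. A unipotent conjugation brings the image of `h₁ + h₂` in the Levi factor back
to `h₁ + h₂`; since `ad (h₁ + h₂)` has eigenvalues `0, 1, -1` on the radical, but `±2` on `x₃` and
`y₃`, the Levi factor is then `A₁¹`. What remains of `L` is an `A₁¹`-submodule of the radical,
which is the sum of the inequivalent irreducible modules `⟨h₁ - h₂⟩` and `⟨x₂, y₁⟩`.
Dimensions and invariant lines tell the five subalgebras apart.
-/

noncomputable section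

namespace LeviA2

section Solvable

theorem isSolvable_of_lie_lie_lie_eq_zero {R L : Type*} [CommRing R] [LieRing L] [LieAlgebra R L]
    (h : ∀ x y z w : L, ⁅⁅x, y⁆, ⁅z, w⁆⁆ = 0) : IsSolvable L := by
  apply IsSolvable.mk (R := R) (k := 2)
  change ⁅derivedSeries R L 1, derivedSeries R L 1⁆ = ⊥
  rw [LieSubmodule.lie_eq_bot_iff]
  intro x hx y hy
  have hspan := coe_derivedSeries_one_eq R L
  rw [LieIdeal.toLieSubalgebra_toSubmodule] at hspan
  rw [← LieSubmodule.mem_toSubmodule, hspan] at hx hy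
  induction hx, hy using Submodule.span_induction₂ with
  | mem_mem x y hx hy =>
    obtain ⟨a, b, rfl⟩ := hx
    obtain ⟨c, d, rfl⟩ := hy
    exact h a b c d
  | zero_left y _ => exact zero_lie y
  | zero_right x _ => exact lie_zero x
  | add_left x y z _ _ _ h1 h2 => rw [add_lie, h1, h2, add_zero]
  | add_right x y z _ _ _ h1 h2 => rw [lie_add, h1, h2, add_zero]
  | smul_left r x y _ _ h => rw [smul_lie, h, smul_zero]
  | smul_right r x y _ _ h => rw [lie_smul, h, smul_zero]

theorem isSolvable_of_finrank_le_two {k L : Type*} [Field k] [LieRing L] [LieAlgebra k L]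
    [Module.Finite k L] (h : Module.finrank k L ≤ 2) : IsSolvable L := by
  by_cases hab : IsLieAbelian L
  · infer_instance
  obtain ⟨a, b, hne⟩ : ∃ a b : L, ⁅a, b⁆ ≠ 0 := by
    by_contra! h0
    exact hab ⟨h0⟩
  have hli : LinearIndependent k ![a, b] := by
    rw [LinearIndependent.pair_iff]
    intro s t hst
    have hb : t • ⁅a, b⁆ = 0 := by simpa using congrArg (fun x ↦ ⁅a, x⁆) hst
    have ha : s • ⁅a, b⁆ = 0 := by simpa using congrArg (fun x ↦ ⁅x, b⁆) hst
    exact ⟨(smul_eq_zero.1 ha).resolve_right hne, (smul_eq_zero.1 hb).resolve_right hne⟩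
  have hspan : ∀ x : L, ∃ s t : k, s • a + t • b = x := by
    intro x
    have htop := hli.span_eq_top_of_card_eq_finrank' (le_antisymm hli.fintype_card_le_finrank h)
    rw [← Submodule.mem_span_pair, ← Matrix.range_cons_cons_empty, htop]
    trivial
  have hbracket : ∀ x y : L, ∃ c : k, ⁅x, y⁆ = c • ⁅a, b⁆ := by
    intro x y
    obtain ⟨s, t, rfl⟩ := hspan x
    obtain ⟨s', t', rfl⟩ := hspan y
    refine ⟨s * t' - t * s', ?_⟩
    simp only [add_lie, lie_add, smul_lie, lie_smul, lie_self, ← lie_skew a b]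
    module
  refine isSolvable_of_lie_lie_lie_eq_zero (R := k) fun x y z w ↦ ?_
  obtain ⟨c, hc⟩ := hbracket x y
  obtain ⟨d, hd⟩ := hbracket z w
  rw [hc, hd, smul_lie, lie_smul, lie_self, smul_zero, smul_zero]

theorem two_lt_finrank_of_hasTrivialRadical (k L : Type*) [Field k] [LieRing L] [LieAlgebra k L]
    [Module.Finite k L] [Nontrivial L] [HasTrivialRadical k L] : 2 < Module.finrank k L := by
  by_contra! h
  have := isSolvable_of_finrank_le_two h
  have hbot : (⊤ : LieIdeal k L) = ⊥ := HasTrivialRadical.eq_bot_of_isSolvable _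
  exact top_ne_bot hbot

theorem injective_of_isSolvable_ker {R L L' : Type*} [CommRing R] [LieRing L] [LieAlgebra R L]
    [LieRing L'] [LieAlgebra R L'] [HasTrivialRadical R L] (f : L →ₗ⁅R⁆ L') [IsSolvable f.ker] :
    Function.Injective f :=
  f.ker_eq_bot.1 (HasTrivialRadical.eq_bot_of_isSolvable _)

end Solvable

section SpecialLinear

open LieModule

variable {n K : Type*} [Fintype n] [DecidableEq n] [Field K]

theorem trace_toEnd_sl {R : Type*} [CommRing R] (X : sl n R) :
    LinearMap.trace R (n → R) (toEnd R (sl n R) (n → R) X) = 0 := by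
  have h : toEnd R (sl n R) (n → R) X = Matrix.toLin' X.val := rfl
  rw [h, Matrix.trace_toLin'_eq]
  exact X.2

theorem isIrreducible_sl [Nontrivial n] : IsIrreducible K (sl n K) (n → K) := by
  refine .mk fun N hN ↦ ?_
  obtain ⟨v, hv, hv0⟩ := N.toSubmodule.ne_bot_iff.1 (mt N.toSubmodule_eq_bot.1 hN)
  obtain ⟨j, hj⟩ := Function.ne_iff.1 hv0
  have hsingle {i j : n} (hij : i ≠ j) {w : n → K} (hw : w ∈ N) (hwj : w j ≠ 0) :
      Pi.single i 1 ∈ N := by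
    have hlie := N.lie_mem (x := single i j hij (w j)⁻¹) hw
    rwa [LieSubalgebra.coe_bracket_of_module, val_single, Matrix.lie_apply,
      Matrix.single_mulVec, inv_mul_cancel₀ hwj] at hlie
  obtain ⟨i, hij⟩ := exists_ne j
  have hj : Pi.single j 1 ∈ N := hsingle hij.symm (hsingle hij hv hj) (by simp)
  have hbasis (i : n) : Pi.single i 1 ∈ N := by
    by_cases h : i = j
    · exact h ▸ hj
    · exact hsingle h hj (by simp)
  rw [← LieSubmodule.toSubmodule_eq_top, eq_top_iff, ← (Pi.basisFun K n).span_eq,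
    Submodule.span_le]
  rintro _ ⟨i, rfl⟩
  simpa using hbasis i

theorem hasTrivialRadical_sl [CharZero K] [IsAlgClosed K] [Nontrivial n] :
    HasTrivialRadical K (sl n K) :=
  have := isIrreducible_sl (n := n) (K := K)
  hasTrivialRadical_of_isIrreducible_of_isFaithful K _ (n → K) trace_toEnd_sl

theorem finrank_sl_add_one [Nonempty n] :
    Module.finrank K (sl n K) + 1 = Fintype.card n * Fintype.card n := by
  have hsurj : Function.Surjective (Matrix.traceLinearMap n K K) := fun c ↦
    ⟨Matrix.single (Classical.arbitrary n) (Classical.arbitrary n) c,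
      Matrix.trace_single_eq_same _ c⟩
  have h := LinearMap.finrank_range_add_finrank_ker (Matrix.traceLinearMap n K K)
  rw [LinearMap.range_eq_top.2 hsurj, finrank_top, Module.finrank_self, Module.finrank_matrix,
    Module.finrank_self, mul_one, add_comm] at h
  exact h

/-- The automorphism `X ↦ -Xᵀ` of `𝔰𝔩(n)`; a subalgebra acts on the dual of the standard module as
its image acts on the standard module. -/
def negTranspose (n R : Type*) [Fintype n] [DecidableEq n] [CommRing R] :
    sl n R ≃ₗ⁅R⁆ sl n R where
  toFun X := ⟨-X.val.transpose, LinearMap.mem_ker.2 <| by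
    simpa [Matrix.trace_transpose] using LinearMap.mem_ker.1 X.2⟩
  invFun X := ⟨-X.val.transpose, LinearMap.mem_ker.2 <| by
    simpa [Matrix.trace_transpose] using LinearMap.mem_ker.1 X.2⟩
  map_add' X Y := Subtype.ext <|
    (congrArg Neg.neg (Matrix.transpose_add X.val Y.val)).trans (neg_add _ _)
  map_smul' c X := Subtype.ext <|
    (congrArg Neg.neg (Matrix.transpose_smul c X.val)).trans (smul_neg c _).symm
  map_lie' {X Y} := Subtype.ext <| by
    simp only [sl_bracket, Matrix.transpose_sub, Matrix.transpose_mul, neg_mul_neg, neg_sub]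
  left_inv X := Subtype.ext <| by simp only [Matrix.transpose_neg, Matrix.transpose_transpose,
    neg_neg]
  right_inv X := Subtype.ext <| by simp only [Matrix.transpose_neg, Matrix.transpose_transpose,
    neg_neg]

theorem negTranspose_val {n R : Type*} [Fintype n] [DecidableEq n] [CommRing R] (X : sl n R) :
    (negTranspose n R X).val = -X.val.transpose := rfl

end SpecialLinear

theorem range_ne_bot {R K g : Type*} [CommRing R] [LieRing K] [LieAlgebra R K] [LieRing g]
    [LieAlgebra R g] [Nontrivial K] {p : K →ₗ⁅R⁆ g} (hp : Function.Injective p) : p.range ≠ ⊥ := by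
  obtain ⟨u, hu⟩ := exists_ne (0 : K)
  intro hbot
  exact hu ((map_eq_zero_iff p hp).1 ((LieSubalgebra.eq_bot_iff _).1 hbot _ ⟨u, rfl⟩))

section SemiDirect

open SemiDirectSum

variable {R K L g : Type*} [CommRing R] [LieRing K] [LieAlgebra R K] [LieRing L] [LieAlgebra R L]
  [LieRing g] [LieAlgebra R g] {ψ : L →ₗ⁅R⁆ LieDerivation R K K}

/-- The homomorphism `K ⋊⁅ψ⁆ L → g`, `(u, x) ↦ p u + q x`, induced by homomorphisms `p` and `q` for
which `q` turns the action `ψ` into the adjoint action. -/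
def semiDirectLift (p : K →ₗ⁅R⁆ g) (q : L →ₗ⁅R⁆ g) (hpq : ∀ x u, p (ψ x u) = ⁅q x, p u⁆) :
    K ⋊⁅ψ⁆ L →ₗ⁅R⁆ g where
  toFun a := p a.left + q a.right
  map_add' a b := by simp only [add_eq_mk, map_add]; abel
  map_smul' c a := by simp only [smul_eq_mk, map_smul, smul_add, RingHom.id_apply]
  map_lie' {a b} := by
    simp only [lie_eq_mk, map_add, map_sub, LieHom.map_lie, hpq, add_lie, lie_add,
      ← lie_skew (q b.right)]
    abel

variable {p : K →ₗ⁅R⁆ g} {q : L →ₗ⁅R⁆ g} (hpq : ∀ x u, p (ψ x u) = ⁅q x, p u⁆)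

theorem semiDirectLift_apply (a : K ⋊⁅ψ⁆ L) :
    semiDirectLift p q hpq a = p a.left + q a.right := rfl

theorem semiDirectLift_injective (hp : Function.Injective p) (hq : Function.Injective q)
    (hdisj : Disjoint q.range p.range) : Function.Injective (semiDirectLift p q hpq) := by
  rw [injective_iff_map_eq_zero]
  intro a ha
  rw [semiDirectLift_apply, add_eq_zero_iff_neg_eq, ← map_neg] at ha
  have hqa : q a.right = 0 := hdisj.le_bot ⟨⟨_, rfl⟩, ⟨_, ha⟩⟩
  have hr : a.right = 0 := (map_eq_zero_iff q hq).1 hqa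
  have hl : a.left = 0 := by simpa using (map_eq_zero_iff p hp).1 (ha.trans hqa)
  exact SemiDirectSum.ext hl hr

theorem range_semiDirectLift : (semiDirectLift p q hpq).range = q.range ⊔ p.range := by
  apply le_antisymm
  · rintro _ ⟨a, rfl⟩
    exact add_mem (le_sup_right (a := q.range) ⟨a.left, rfl⟩)
      (le_sup_left (b := p.range) ⟨a.right, rfl⟩)
  · refine sup_le ?_ ?_
    · rintro _ ⟨x, rfl⟩
      exact ⟨inr ψ x, by simp [semiDirectLift_apply]⟩
    · rintro _ ⟨u, rfl⟩
      exact ⟨inl ψ u, by simp [semiDirectLift_apply]⟩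

/-- The isomorphism of the sum of the ranges of `q` and `p` with the external semidirect sum,
inverse to `semiDirectLift`. -/
def supRangeEquiv (hp : Function.Injective p) (hq : Function.Injective q)
    (hdisj : Disjoint q.range p.range) : ↥(q.range ⊔ p.range) ≃ₗ⁅R⁆ K ⋊⁅ψ⁆ L :=
  (LieEquiv.ofEq _ _ (congrArg _ (range_semiDirectLift hpq).symm)).trans
    (LieEquiv.ofInjective _ (semiDirectLift_injective hpq hp hq hdisj)).symm

end SemiDirect

theorem isSemisimple_of_equiv {k S S' : Type*} [Field k] [CharZero k] [LieRing S] [LieAlgebra k S]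
    [LieRing S'] [LieAlgebra k S'] [Module.Finite k S] [HasTrivialRadical k S] (e : S ≃ₗ⁅k⁆ S') :
    IsSemisimple k S' :=
  have : Module.Finite k S' := .equiv e.toLinearEquiv
  have := e.isKilling
  inferInstance

section LineStabilizer

variable {R L M : Type*} [CommRing R] [LieRing L] [LieAlgebra R L] [AddCommGroup M] [Module R M]
  [LieRingModule L M] [LieModule R L M]

variable (R L) in
/-- The elements of `L` that map the line spanned by `m` into itself. -/
def lineStabilizer (m : M) : LieSubalgebra R L where
  carrier := {x | ∃ c : R, ⁅x, m⁆ = c • m}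
  add_mem' := by
    rintro x y ⟨c, hc⟩ ⟨d, hd⟩
    exact ⟨c + d, by rw [add_lie, hc, hd, add_smul]⟩
  zero_mem' := ⟨0, by rw [zero_lie, zero_smul]⟩
  smul_mem' := by
    rintro a x ⟨c, hc⟩
    exact ⟨a * c, by rw [smul_lie, hc, mul_smul]⟩
  lie_mem' := by
    rintro x y ⟨c, hc⟩ ⟨d, hd⟩
    exact ⟨0, by rw [lie_lie, hc, hd, lie_smul, lie_smul, hc, hd, smul_comm, sub_self, zero_smul]⟩

theorem mem_lineStabilizer {m : M} {x : L} :
    x ∈ lineStabilizer R L m ↔ ∃ c : R, ⁅x, m⁆ = c • m := Iff.rfl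

end LineStabilizer

section LeviDecomposable

variable {g g' : Type*} [LieRing g] [LieAlgebra ℂ g] [LieRing g'] [LieAlgebra ℂ g']
  {S R L : LieSubalgebra ℂ g}

theorem IsSemidirectSum.map (h : IsSemidirectSum S R L) {f : g →ₗ⁅ℂ⁆ g'}
    (hf : Function.Injective f) : IsSemidirectSum (S.map f) (R.map f) (L.map f) where
  inf_eq_bot := by
    simp only [LieSubalgebra.map, ← Submodule.map_inf _ hf, h.inf_eq_bot, Submodule.map_bot]
  sup_eq := by
    simp only [LieSubalgebra.map, ← Submodule.map_sup, h.sup_eq]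
  ideal := by
    rintro _ ⟨x, hx, rfl⟩ _ ⟨y, hy, rfl⟩
    exact ⟨⁅x, y⁆, h.ideal x hx y hy, f.map_lie x y⟩

theorem IsLeviDecomposable.map [Module.Finite ℂ g] (h : IsLeviDecomposable L) (e : g ≃ₗ⁅ℂ⁆ g') :
    IsLeviDecomposable (L.map e.toLieHom) := by
  obtain ⟨S, R, hS, hR, hss, hsolv, hSR⟩ := h
  have map_ne_bot {H : LieSubalgebra ℂ g} (hH : H ≠ ⊥) : H.map e.toLieHom ≠ ⊥ := by
    obtain ⟨x, hx, hx0⟩ : ∃ x ∈ H, x ≠ 0 := by simpa [H.eq_bot_iff] using hH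
    intro hbot
    exact hx0 (e.injective (((LieSubalgebra.eq_bot_iff _).1 hbot _ ⟨x, hx, rfl⟩).trans
      e.toLieHom.map_zero.symm))
  exact ⟨_, _, map_ne_bot hS, map_ne_bot hR, isSemisimple_of_equiv (e.lieSubalgebraMap S),
    (e.lieSubalgebraMap R).symm.injective.lieAlgebra_isSolvable, hSR.map e.injective⟩

theorem IsLeviDecomposable.not_hasTrivialRadical (h : IsLeviDecomposable L) :
    ¬ HasTrivialRadical ℂ L := by
  obtain ⟨S, R, -, hR, -, hsolv, hSR⟩ := h
  have hle : R ≤ L := (LieSubalgebra.toSubmodule_le_toSubmodule R L).1 (hSR.sup_eq ▸ le_sup_right)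
  obtain ⟨I, hI⟩ := (LieSubalgebra.exists_nested_lieIdeal_coe_eq_iff ℂ R hle).2
    fun x y hx hy ↦ hSR.ideal x hx y hy
  obtain ⟨x, hx, hx0⟩ := R.toSubmodule.ne_bot_iff.1 (mt R.toSubmodule_eq_bot.1 hR)
  have hmem {y : L} : y ∈ I ↔ y.1 ∈ R := by
    rw [← LieSubalgebra.mem_ofLe hle, ← hI]
    exact Iff.rfl
  intro hrad
  have : IsSolvable I := by
    change IsSolvable I.toLieSubalgebra
    rw [hI]
    exact (LieSubalgebra.equivOfLe hle).symm.injective.lieAlgebra_isSolvable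
  have hbot : I = ⊥ := HasTrivialRadical.eq_bot_of_isSolvable I
  have hxI : (⟨x, hle hx⟩ : L) ∈ I := hmem.2 hx
  rw [hbot, LieSubmodule.mem_bot] at hxI
  exact hx0 (congrArg Subtype.val hxI)

end LeviDecomposable

section SemidirectRange

variable {K L g : Type*} [LieRing K] [LieAlgebra ℂ K] [LieRing L] [LieAlgebra ℂ L]
  [LieRing g] [LieAlgebra ℂ g] {ψ : L →ₗ⁅ℂ⁆ LieDerivation ℂ K K}
  {p : K →ₗ⁅ℂ⁆ g} {q : L →ₗ⁅ℂ⁆ g}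

theorem isSemidirectSum_range (hpq : ∀ x u, p (ψ x u) = ⁅q x, p u⁆)
    (hdisj : Disjoint q.range p.range) :
    IsSemidirectSum q.range p.range (q.range ⊔ p.range) where
  inf_eq_bot := by
    rw [← LieSubalgebra.inf_toSubmodule, hdisj.eq_bot, LieSubalgebra.bot_toSubmodule]
  sup_eq := by
    rw [← range_semiDirectLift hpq]
    ext z
    simp only [Submodule.mem_sup, LieSubalgebra.mem_toSubmodule, LieHom.mem_range]
    constructor
    · rintro ⟨_, ⟨x, rfl⟩, _, ⟨u, rfl⟩, rfl⟩
      exact ⟨⟨u, x⟩, add_comm _ _⟩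
    · rintro ⟨a, rfl⟩
      exact ⟨_, ⟨a.right, rfl⟩, _, ⟨a.left, rfl⟩, add_comm _ _⟩
  ideal := by
    rw [← range_semiDirectLift hpq]
    rintro _ ⟨a, rfl⟩ _ ⟨u, rfl⟩
    exact ⟨⁅a.left, u⁆ + ψ a.right u, by simp [semiDirectLift_apply, hpq]⟩

theorem isLeviDecomposable_sup_range [Nontrivial K] [IsSolvable K] [Nontrivial L]
    [HasTrivialRadical ℂ L] [Module.Finite ℂ L]
    (hpq : ∀ x u, p (ψ x u) = ⁅q x, p u⁆) (hp : Function.Injective p)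
    (hq : Function.Injective q) (hdisj : Disjoint q.range p.range) :
    IsLeviDecomposable (q.range ⊔ p.range) :=
  ⟨q.range, p.range, range_ne_bot hq, range_ne_bot hp,
    isSemisimple_of_equiv (LieEquiv.ofInjective q hq), inferInstance,
    isSemidirectSum_range hpq hdisj⟩

end SemidirectRange

theorem A2_ext {X Y : A2} (h : ∀ i j, X.val i j = Y.val i j) : X = Y :=
  Subtype.ext (Matrix.ext h)

theorem trace_A2 (X : A2) : X.val 0 0 + X.val 1 1 + X.val 2 2 = 0 := by
  have h : Matrix.trace X.val = 0 := X.property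
  rwa [Matrix.trace_fin_three] at h

theorem A1_one_one (M : A1) : M.val 1 1 = -M.val 0 0 := by
  have h : Matrix.trace M.val = 0 := M.property
  rw [Matrix.trace_fin_two] at h
  linear_combination h

theorem lie_val_apply (X Y : A2) (i j : Fin 3) :
    ⁅X, Y⁆.val i j = ∑ k, (X.val i k * Y.val k j - Y.val i k * X.val k j) := by
  rw [sl_bracket, Matrix.sub_apply, Matrix.mul_apply, Matrix.mul_apply, Finset.sum_sub_distrib]

/-! ### The embeddings of `A₁`, `J`, `K₁` and `L₂` -/

/-- The identity map of `ℂ`, as a coordinate on `J`. -/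
def J.coord : J ≃ₗ[ℂ] ℂ := LinearEquiv.refl ℂ ℂ

/-- The coordinates with respect to the basis `z₁, z₂` of `K₁`. -/
def K1.coord : K1 ≃ₗ[ℂ] (Fin 2 → ℂ) := LinearEquiv.refl ℂ (Fin 2 → ℂ)

/-- The coordinates with respect to the basis `z₁, z₂, z₃` of `L₂`. -/
def L2.coord : L2 ≃ₗ[ℂ] (Fin 3 → ℂ) := LinearEquiv.refl ℂ (Fin 3 → ℂ)

theorem L2.coord_lie (u v : L2) : L2.coord ⁅u, v⁆ = bracketL2 (L2.coord u) (L2.coord v) := rfl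

theorem chi_val (M : A1) :
    (chi M).val = !![M.val 0 0, 0, -M.val 0 1; 0, 0, 0; -M.val 1 0, 0, -M.val 0 0] := by
  ext i j
  fin_cases i <;> fin_cases j <;> simp [chi, x₃, y₃, h₁, h₂, chevalley]

theorem psi1_eq (u : K1) : psi1 u = K1.coord u 0 • x₁ + K1.coord u 1 • y₂ := rfl

theorem psi2_val (u : L2) :
    (psi2 u).val = !![L2.coord u 2 / 3, L2.coord u 0, 0;
      0, -2 * L2.coord u 2 / 3, 0; 0, L2.coord u 1, L2.coord u 2 / 3] := by
  have h (k) : L2.coord u k = (u : Fin 3 → ℂ) k := rfl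
  ext i j
  fin_cases i <;> fin_cases j <;> simp [psi2, x₁, y₂, h₁, h₂, chevalley, h] <;> ring

/-- `χ` as a homomorphism of Lie algebras. -/
def chiHom : A1 →ₗ⁅ℂ⁆ A2 where
  toFun := chi
  map_add' M N := by
    refine A2_ext fun i j ↦ ?_
    fin_cases i <;> fin_cases j <;> simp [chi_val] <;> ring
  map_smul' c M := by
    refine A2_ext fun i j ↦ ?_
    fin_cases i <;> fin_cases j <;> simp [chi_val]
  map_lie' {M N} := by
    have h : ⁅M, N⁆.val = M.val * N.val - N.val * M.val := sl_bracket _ _ M N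
    refine A2_ext fun i j ↦ ?_
    rw [lie_val_apply]
    fin_cases i <;> fin_cases j <;>
      simp [chi_val, h, Matrix.mul_apply, Fin.sum_univ_succ, A1_one_one] <;> ring

theorem lie_x₁_y₂ : ⁅x₁, y₂⁆ = 0 := by
  refine A2_ext fun i j ↦ ?_
  rw [lie_val_apply]
  fin_cases i <;> fin_cases j <;> simp [x₁, y₂, chevalley, Fin.sum_univ_succ]

/-- `ψ₁` as a homomorphism of Lie algebras. -/
def psi1Hom : K1 →ₗ⁅ℂ⁆ A2 where
  toFun := psi1
  map_add' u v := by simp only [psi1_eq, map_add, Pi.add_apply]; module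
  map_smul' c u := by
    simp only [psi1_eq, map_smul, Pi.smul_apply, smul_assoc, smul_add, RingHom.id_apply]
  map_lie' {u v} := by
    have h : K1.coord ⁅u, v⁆ = 0 := rfl
    simp [psi1_eq, h, lie_x₁_y₂, ← lie_skew y₂ x₁]

/-- `ψ₂` as a homomorphism of Lie algebras. -/
def psi2Hom : L2 →ₗ⁅ℂ⁆ A2 where
  toFun := psi2
  map_add' u v := by
    refine A2_ext fun i j ↦ ?_
    fin_cases i <;> fin_cases j <;> simp [psi2_val] <;> ring
  map_smul' c u := by
    refine A2_ext fun i j ↦ ?_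
    fin_cases i <;> fin_cases j <;> simp [psi2_val] <;> ring
  map_lie' {u v} := by
    refine A2_ext fun i j ↦ ?_
    rw [lie_val_apply]
    fin_cases i <;> fin_cases j <;>
      simp [psi2_val, bracketL2, L2.coord_lie, Fin.sum_univ_succ] <;> ring

/-- The embedding of `J` as the line spanned by `h₁ - h₂`. -/
def jHom : J →ₗ⁅ℂ⁆ A2 where
  toLinearMap := LinearMap.toSpanSingleton ℂ A2 (h₁ - h₂) ∘ₗ J.coord.toLinearMap
  map_lie' {s t} := by
    have h : J.coord ⁅s, t⁆ = 0 := rfl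
    simp [h]

theorem jHom_apply (t : J) : jHom t = J.coord t • (h₁ - h₂) := rfl

/-- The projection `A₂ → A₁` onto the block of the first and third coordinates, made traceless;
it is a left inverse of `χ`, which puts a matrix into this block with the off-diagonal signs
reversed. -/
def blockPart : A2 →ₗ[ℂ] A1 where
  toFun X := ⟨!![(X.val 0 0 - X.val 2 2) / 2, -X.val 0 2; -X.val 2 0, (X.val 2 2 - X.val 0 0) / 2],
    LinearMap.mem_ker.2 (by simp [Matrix.trace_fin_two]; ring)⟩
  map_add' X Y := by
    ext i j
    fin_cases i <;> fin_cases j <;> simp <;> ring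
  map_smul' c X := by
    ext i j
    fin_cases i <;> fin_cases j <;> simp <;> ring

theorem blockPart_val (X : A2) :
    (blockPart X).val = !![(X.val 0 0 - X.val 2 2) / 2, -X.val 0 2;
      -X.val 2 0, (X.val 2 2 - X.val 0 0) / 2] := rfl

theorem blockPart_chi (M : A1) : blockPart (chi M) = M := by
  ext i j
  fin_cases i <;> fin_cases j <;> simp [blockPart_val, chi_val, A1_one_one]

theorem blockPart_psi2 (u : L2) : blockPart (psi2 u) = 0 := by
  ext i j
  fin_cases i <;> fin_cases j <;> simp [blockPart_val, psi2_val]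

theorem chiHom_injective : Function.Injective chiHom :=
  Function.LeftInverse.injective blockPart_chi

theorem psi2Hom_injective : Function.Injective psi2Hom := by
  refine fun u v huv ↦ L2.coord.injective (funext fun k ↦ ?_)
  have h (i j) : (psi2 u).val i j = (psi2 v).val i j := congrArg (fun X : A2 ↦ X.val i j) huv
  have h0 := h 0 1
  have h1 := h 2 1
  have h2 := h 0 0
  simp only [psi2_val] at h0 h1 h2
  fin_cases k
  · simpa using h0
  · simpa using h1
  · simpa using h2

theorem psi1Hom_injective : Function.Injective psi1Hom := by
  refine fun u v huv ↦ K1.coord.injective (funext fun k ↦ ?_)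
  have h (i j) : (psi1 u).val i j = (psi1 v).val i j := congrArg (fun X : A2 ↦ X.val i j) huv
  fin_cases k
  · simpa [psi1_eq, x₁, y₂, chevalley] using h 0 1
  · simpa [psi1_eq, x₁, y₂, chevalley] using h 2 1

theorem jHom_injective : Function.Injective jHom := by
  refine fun s t hst ↦ J.coord.injective ?_
  have h : (jHom s).val 0 0 = (jHom t).val 0 0 := congrArg (fun X : A2 ↦ X.val 0 0) hst
  simpa [jHom_apply, h₁, h₂, chevalley] using h

theorem subset_gen {W : Set A2} {X : A2} (h : X ∈ W) : X ∈ gen W :=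
  LieSubalgebra.subset_lieSpan h

theorem range_chiHom : chiHom.range = A11 := by
  apply le_antisymm
  · rintro _ ⟨M, rfl⟩
    exact add_mem (add_mem (A11.smul_mem _ (subset_gen (by simp)))
      (A11.smul_mem _ (subset_gen (by simp)))) (A11.smul_mem _ (subset_gen (by simp)))
  · refine LieSubalgebra.lieSpan_le.2 ?_
    rintro _ (rfl | rfl | rfl)
    · exact ⟨single 0 1 (by decide) 1, by simp [chiHom, chi]⟩
    · exact ⟨single 1 0 (by decide) 1, by simp [chiHom, chi]⟩
    · exact ⟨singleSubSingle 0 1 1, by simp [chiHom, chi]⟩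

theorem range_jHom : jHom.range = radicalPart 0 := by
  apply le_antisymm
  · rintro _ ⟨t, rfl⟩
    exact LieSubalgebra.smul_mem _ _ (subset_gen (by simp))
  · refine LieSubalgebra.lieSpan_le.2 ?_
    rintro _ rfl
    exact ⟨J.coord.symm 1, by simp [jHom_apply]⟩

theorem range_psi1Hom : psi1Hom.range = radicalPart 1 := by
  apply le_antisymm
  · rintro _ ⟨u, rfl⟩
    exact add_mem (LieSubalgebra.smul_mem _ _ (subset_gen (by simp)))
      (LieSubalgebra.smul_mem _ _ (subset_gen (by simp)))
  · refine LieSubalgebra.lieSpan_le.2 ?_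
    rintro _ (rfl | rfl)
    · exact ⟨K1.coord.symm ![1, 0], by simp [psi1Hom, psi1_eq]⟩
    · exact ⟨K1.coord.symm ![0, 1], by simp [psi1Hom, psi1_eq]⟩

theorem psi2_eq (u : L2) : psi2 u = L2.coord u 0 • x₁ + L2.coord u 1 • y₂
      + L2.coord u 2 • ((1 / 3 : ℂ) • (h₁ - h₂)) := rfl

theorem range_psi2Hom : psi2Hom.range = radicalPart 3 := by
  apply le_antisymm
  · rintro _ ⟨u, rfl⟩
    exact add_mem (add_mem (LieSubalgebra.smul_mem _ _ (subset_gen (by simp)))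
      (LieSubalgebra.smul_mem _ _ (subset_gen (by simp))))
      (LieSubalgebra.smul_mem _ _ (LieSubalgebra.smul_mem _ _ (subset_gen (by simp))))
  · refine LieSubalgebra.lieSpan_le.2 ?_
    rintro _ (rfl | rfl | rfl)
    · exact ⟨L2.coord.symm ![0, 0, 3], by simp [psi2Hom, psi2_eq]⟩
    · exact ⟨L2.coord.symm ![1, 0, 0], by simp [psi2Hom, psi2_eq]⟩
    · exact ⟨L2.coord.symm ![0, 1, 0], by simp [psi2Hom, psi2_eq]⟩

theorem disjoint_range_psi2Hom : Disjoint chiHom.range psi2Hom.range := by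
  rw [disjoint_iff_inf_le]
  rintro _ ⟨⟨M, rfl⟩, ⟨u, hu⟩⟩
  have hM : M = 0 := by rw [← blockPart_chi M, ← blockPart_psi2 u]; exact congrArg _ hu.symm
  rw [hM, map_zero]
  exact zero_mem _

theorem disjoint_range_psi1Hom : Disjoint chiHom.range psi1Hom.range := by
  refine disjoint_range_psi2Hom.mono_right ?_
  rw [range_psi1Hom, range_psi2Hom]
  exact LieSubalgebra.lieSpan_mono (Set.subset_insert _ _)

theorem disjoint_range_jHom : Disjoint chiHom.range jHom.range := by
  refine disjoint_range_psi2Hom.mono_right ?_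
  rw [range_jHom, range_psi2Hom]
  exact LieSubalgebra.lieSpan_mono (by simp)

/-! ### Duality and the five subalgebras -/

theorem map_negTranspose_gen {W W' : Set A2} (h : negTranspose (Fin 3) ℂ '' W = -W') :
    (gen W).map (negTranspose (Fin 3) ℂ).toLieHom = gen W' := by
  rw [LieSubalgebra.map_lieSpan, gen, ← LieSubalgebra.lieSpan_neg ℂ (s := W')]
  exact congrArg _ h

theorem negTranspose_chevalley (a b c d e c' d' e' : ℂ) :
    negTranspose (Fin 3) ℂ (chevalley a b c d e c' d' e') =
      -chevalley a b c' d' e' c d e := by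
  refine A2_ext fun i j ↦ ?_
  fin_cases i <;> fin_cases j <;> simp [negTranspose_val, chevalley]

theorem negTranspose_h₁_add_h₂ : negTranspose (Fin 3) ℂ (h₁ + h₂) = -(h₁ + h₂) := by
  rw [map_add, h₁, h₂, negTranspose_chevalley, negTranspose_chevalley, neg_add]

theorem negTranspose_h₁_sub_h₂ : negTranspose (Fin 3) ℂ (h₁ - h₂) = -(h₁ - h₂) := by
  rw [map_sub, h₁, h₂, negTranspose_chevalley, negTranspose_chevalley, neg_sub_neg, neg_sub]

theorem map_negTranspose_A11 : A11.map (negTranspose (Fin 3) ℂ).toLieHom = A11 := by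
  refine map_negTranspose_gen ?_
  simp only [Set.image_insert_eq, Set.image_singleton, Set.neg_insert, Set.neg_singleton,
    negTranspose_h₁_add_h₂]
  rw [x₃, y₃, negTranspose_chevalley, negTranspose_chevalley, Set.insert_comm]

/-- The involution of the list of Levi decomposable subalgebras induced by `negTranspose`. -/
def dualIndex : Fin 5 → Fin 5 := ![0, 2, 1, 4, 3]

theorem map_negTranspose_radicalPart (i : Fin 5) :
    (radicalPart i).map (negTranspose (Fin 3) ℂ).toLieHom = radicalPart (dualIndex i) := by
  fin_cases i <;> refine map_negTranspose_gen ?_ <;>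
    simp only [Set.image_insert_eq, Set.image_singleton, Set.neg_insert, Set.neg_singleton,
      negTranspose_h₁_sub_h₂] <;>
    simp only [x₁, x₂, y₁, y₂, negTranspose_chevalley, Set.pair_comm]

theorem map_negTranspose_leviSubalgebra (i : Fin 5) :
    (leviSubalgebra i).map (negTranspose (Fin 3) ℂ).toLieHom = leviSubalgebra (dualIndex i) := by
  have hmap : GaloisConnection (LieSubalgebra.map (negTranspose (Fin 3) ℂ).toLieHom) _ :=
    LieSubalgebra.gc_map_comap
  rw [leviSubalgebra, hmap.l_sup, map_negTranspose_A11,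
    map_negTranspose_radicalPart, leviSubalgebra]

instance : Nontrivial J := J.coord.toEquiv.nontrivial
instance : Nontrivial K1 := K1.coord.toEquiv.nontrivial
instance : Nontrivial L2 := L2.coord.toEquiv.nontrivial

instance : Module.Finite ℂ J := .equiv J.coord.symm
instance : Module.Finite ℂ K1 := .equiv K1.coord.symm
instance : Module.Finite ℂ L2 := .equiv L2.coord.symm

instance : IsLieAbelian J := ⟨fun _ _ ↦ rfl⟩
instance : IsLieAbelian K1 := ⟨fun _ _ ↦ rfl⟩

instance : IsSolvable L2 := by
  refine isSolvable_of_lie_lie_lie_eq_zero (R := ℂ) fun x y z w ↦ L2.coord.injective ?_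
  ext i
  fin_cases i <;> simp [L2.coord_lie, bracketL2] <;> ring

theorem finrank_A1 : Module.finrank ℂ A1 = 3 := by
  simpa using finrank_sl_add_one (n := Fin 2) (K := ℂ)

instance : HasTrivialRadical ℂ A1 := hasTrivialRadical_sl

instance : Nontrivial A1 := Module.nontrivial_of_finrank_pos (R := ℂ) (by simp [finrank_A1])

/-- The isomorphism `A₁ ⊕ J ≅ 𝔤𝔩(2)`, with `J` corresponding to the scalar matrices. -/
def prodJEquivMatrix : (A1 × J) ≃ₗ⁅ℂ⁆ Matrix (Fin 2) (Fin 2) ℂ where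
  toFun a := a.1.val + J.coord a.2 • 1
  map_add' a b := by
    rw [Prod.snd_add, map_add, add_smul]
    exact add_add_add_comm _ _ _ _
  map_smul' c a := by simp [smul_smul]
  map_lie' {a b} := by
    have h : J.coord ⁅a.2, b.2⁆ = 0 := rfl
    have hone (M : Matrix (Fin 2) (Fin 2) ℂ) : ⁅M, (1 : Matrix (Fin 2) (Fin 2) ℂ)⁆ = 0 := by
      rw [Ring.lie_def, mul_one, one_mul, sub_self]
    rw [LieAlgebra.Prod.bracket_apply, h, zero_smul, add_zero]
    simp [hone, ← lie_skew 1 b.1.val]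
  invFun M := (⟨M - (M.trace / 2) • 1, LinearMap.mem_ker.2 (by simp)⟩, J.coord.symm (M.trace / 2))
  left_inv a := by
    have h : a.1.val.trace = 0 := a.1.2
    simp [h]
  right_inv M := by simp

theorem lie_chi_h₁_sub_h₂ (M : A1) : ⁅chi M, h₁ - h₂⁆ = 0 := by
  refine A2_ext fun i j ↦ ?_
  rw [lie_val_apply]
  fin_cases i <;> fin_cases j <;> simp [chi_val, h₁, h₂, chevalley, Fin.sum_univ_succ]

theorem lie_chiHom_jHom (M : A1) (t : J) : ⁅chiHom M, jHom t⁆ = 0 := by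
  rw [jHom_apply, lie_smul]
  exact (congrArg _ (lie_chi_h₁_sub_h₂ M)).trans (smul_zero _)

theorem jHom_zero_apply (M : A1) (t : J) :
    jHom ((0 : A1 →ₗ⁅ℂ⁆ LieDerivation ℂ J J) M t) = ⁅chiHom M, jHom t⁆ :=
  (jHom.map_zero).trans (lie_chiHom_jHom M t).symm

theorem leviSubalgebra_zero_eq : leviSubalgebra 0 = chiHom.range ⊔ jHom.range := by
  rw [range_chiHom, range_jHom, leviSubalgebra]

theorem leviSubalgebra_one_eq : leviSubalgebra 1 = chiHom.range ⊔ psi1Hom.range := by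
  rw [range_chiHom, range_psi1Hom, leviSubalgebra]

theorem leviSubalgebra_three_eq : leviSubalgebra 3 = chiHom.range ⊔ psi2Hom.range := by
  rw [range_chiHom, range_psi2Hom, leviSubalgebra]

theorem forall_of_dualIndex {P : Fin 5 → Prop} (h : ∀ i, P i → P (dualIndex i)) (h0 : P 0)
    (h1 : P 1) (h3 : P 3) (i : Fin 5) : P i := by
  fin_cases i
  exacts [h0, h1, h 1 h1, h3, h 3 h3]

theorem isSemidirectSum_leviSubalgebra (i : Fin 5) :
    IsSemidirectSum A11 (radicalPart i) (leviSubalgebra i) := by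
  induction i using forall_of_dualIndex with
  | h i hi =>
    rw [← map_negTranspose_A11, ← map_negTranspose_radicalPart, ← map_negTranspose_leviSubalgebra]
    exact hi.map (negTranspose _ _).injective
  | h0 =>
    rw [leviSubalgebra_zero_eq, ← range_chiHom, ← range_jHom]
    exact isSemidirectSum_range jHom_zero_apply disjoint_range_jHom
  | h1 =>
    rw [leviSubalgebra_one_eq, ← range_chiHom, ← range_psi1Hom]
    exact isSemidirectSum_range psi1_phi1 disjoint_range_psi1Hom
  | h3 =>
    rw [leviSubalgebra_three_eq, ← range_chiHom, ← range_psi2Hom]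
    exact isSemidirectSum_range psi2_phi2 disjoint_range_psi2Hom

theorem isDirectSum_leviSubalgebra_zero : IsDirectSum A11 (radicalPart 0) (leviSubalgebra 0) where
  toIsSemidirectSum := isSemidirectSum_leviSubalgebra 0
  commute := by
    rw [← range_chiHom, ← range_jHom]
    rintro _ ⟨M, rfl⟩ _ ⟨t, rfl⟩
    exact lie_chiHom_jHom M t

theorem isLeviDecomposable_leviSubalgebra (i : Fin 5) : IsLeviDecomposable (leviSubalgebra i) := by
  induction i using forall_of_dualIndex with
  | h i hi => exact map_negTranspose_leviSubalgebra i ▸ hi.map (negTranspose _ _)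
  | h0 =>
    rw [leviSubalgebra_zero_eq]
    exact isLeviDecomposable_sup_range jHom_zero_apply jHom_injective chiHom_injective
      disjoint_range_jHom
  | h1 =>
    rw [leviSubalgebra_one_eq]
    exact isLeviDecomposable_sup_range psi1_phi1 psi1Hom_injective chiHom_injective
      disjoint_range_psi1Hom
  | h3 =>
    rw [leviSubalgebra_three_eq]
    exact isLeviDecomposable_sup_range psi2_phi2 psi2Hom_injective chiHom_injective
      disjoint_range_psi2Hom

/-- The isomorphism between the members of the list exchanged by `negTranspose`. -/
def leviSubalgebraDualEquiv (i : Fin 5) : leviSubalgebra (dualIndex i) ≃ₗ⁅ℂ⁆ leviSubalgebra i :=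
  ((negTranspose _ _).ofSubalgebras _ _ (map_negTranspose_leviSubalgebra i)).symm

/-- The isomorphism `A₁¹ ⊕ ⟨h₁ - h₂⟩ ≅ A₁ ⊕ J`. -/
def leviSubalgebraZeroEquiv : leviSubalgebra 0 ≃ₗ⁅ℂ⁆ A1 × J :=
  (LieEquiv.ofEq _ _ (congrArg _ leviSubalgebra_zero_eq)).trans <|
    (supRangeEquiv jHom_zero_apply jHom_injective chiHom_injective disjoint_range_jHom).trans <|
      (SemiDirectSum.prod_iso ℂ J A1).trans (LieEquiv.prodComm ℂ J A1)

/-- The isomorphism `A₁¹ ⋉ ⟨x₁, y₂⟩ ≅ A₁ ⋉ K₁`. -/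
def leviSubalgebraOneEquiv : leviSubalgebra 1 ≃ₗ⁅ℂ⁆ K1 ⋊⁅phi1⁆ A1 :=
  (LieEquiv.ofEq _ _ (congrArg _ leviSubalgebra_one_eq)).trans <|
    supRangeEquiv psi1_phi1 psi1Hom_injective chiHom_injective disjoint_range_psi1Hom

/-- The isomorphism `A₁¹ ⋉ ⟨h₁ - h₂, x₁, y₂⟩ ≅ A₁ ⋉ L₂`. -/
def leviSubalgebraThreeEquiv : leviSubalgebra 3 ≃ₗ⁅ℂ⁆ L2 ⋊⁅phi2⁆ A1 :=
  (LieEquiv.ofEq _ _ (congrArg _ leviSubalgebra_three_eq)).trans <|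
    supRangeEquiv psi2_phi2 psi2Hom_injective chiHom_injective disjoint_range_psi2Hom

theorem finrank_leviSubalgebra (i : Fin 5) :
    Module.finrank ℂ (leviSubalgebra i) = ![4, 5, 5, 6, 6] i := by
  have hJ : Module.finrank ℂ J = 1 := by simp [J.coord.finrank_eq]
  have hK1 : Module.finrank ℂ K1 = 2 := by simp [K1.coord.finrank_eq]
  have hL2 : Module.finrank ℂ L2 = 3 := by simp [L2.coord.finrank_eq]
  induction i using forall_of_dualIndex with
  | h i hi =>
    rw [(leviSubalgebraDualEquiv i).toLinearEquiv.finrank_eq, hi]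
    fin_cases i <;> rfl
  | h0 => simp [leviSubalgebraZeroEquiv.toLinearEquiv.finrank_eq, finrank_A1, hJ]
  | h1 => simp [leviSubalgebraOneEquiv.toLinearEquiv.finrank_eq,
      (SemiDirectSum.toProdl phi1).finrank_eq, finrank_A1, hK1]
  | h3 => simp [leviSubalgebraThreeEquiv.toLinearEquiv.finrank_eq,
      (SemiDirectSum.toProdl phi2).finrank_eq, finrank_A1, hL2]

/-! ### Invariant lines -/

/-- The subalgebra `L` of `A₂` has an invariant line in the standard module `ℂ³`. -/
def HasInvariantLine (L : LieSubalgebra ℂ A2) : Prop :=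
  ∃ v : Fin 3 → ℂ, v ≠ 0 ∧ L ≤ lineStabilizer ℂ A2 v

theorem lie_apply_eq (X : A2) (v : Fin 3 → ℂ) : ⁅X, v⁆ = X.val.mulVec v := rfl

theorem innerAut_val (A : Matrix.SpecialLinearGroup (Fin 3) ℂ) (X : A2) :
    (innerAut A X).val = (A⁻¹).val * X.val * A.val := rfl

theorem innerAut_lie (A : Matrix.SpecialLinearGroup (Fin 3) ℂ) (X : A2) (v : Fin 3 → ℂ) :
    A.val.mulVec ⁅innerAut A X, v⁆ = ⁅X, A.val.mulVec v⁆ := by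
  have hA : A.val * (A⁻¹).val = 1 := by
    rw [← Matrix.SpecialLinearGroup.coe_mul, mul_inv_cancel, Matrix.SpecialLinearGroup.coe_one]
  rw [lie_apply_eq, lie_apply_eq, innerAut_val, Matrix.mulVec_mulVec, Matrix.mulVec_mulVec,
    mul_assoc, ← mul_assoc, hA, one_mul]

theorem mulVec_injective (A : Matrix.SpecialLinearGroup (Fin 3) ℂ) :
    Function.Injective A.val.mulVec :=
  Matrix.mulVec_injective_of_det_ne_zero (by simp)

theorem innerAut_mem_lineStabilizer {A : Matrix.SpecialLinearGroup (Fin 3) ℂ} {X : A2}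
    {v : Fin 3 → ℂ} :
    innerAut A X ∈ lineStabilizer ℂ A2 v ↔ X ∈ lineStabilizer ℂ A2 (A.val.mulVec v) := by
  simp only [mem_lineStabilizer, ← innerAut_lie, ← Matrix.mulVec_smul]
  exact exists_congr fun c ↦ (mulVec_injective A).eq_iff.symm

theorem innerAut_innerAut (A B : Matrix.SpecialLinearGroup (Fin 3) ℂ) (X : A2) :
    innerAut B (innerAut A X) = innerAut (A * B) X := by
  ext1
  simp only [innerAut_val, mul_inv_rev, Matrix.SpecialLinearGroup.coe_mul, mul_assoc]

theorem innerAut_one (X : A2) : innerAut 1 X = X := by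
  ext1
  rw [innerAut_val, inv_one, Matrix.SpecialLinearGroup.coe_one, one_mul, mul_one]

theorem Equivalent.trans {L L' L'' : LieSubalgebra ℂ A2} (h : Equivalent L L')
    (h' : Equivalent L' L'') : Equivalent L L'' := by
  obtain ⟨A, rfl⟩ := h
  obtain ⟨B, rfl⟩ := h'
  refine ⟨A * B, LieSubalgebra.ext _ _ fun X ↦ ?_⟩
  simp only [LieSubalgebra.mem_map, LieEquiv.coe_toLieHom, exists_exists_and_eq_and,
    innerAut_innerAut]

theorem Equivalent.symm {L L' : LieSubalgebra ℂ A2} (h : Equivalent L L') : Equivalent L' L := by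
  obtain ⟨A, rfl⟩ := h
  refine ⟨A⁻¹, LieSubalgebra.ext _ _ fun X ↦ ?_⟩
  simp only [LieSubalgebra.mem_map, LieEquiv.coe_toLieHom, exists_exists_and_eq_and,
    innerAut_innerAut, mul_inv_cancel, innerAut_one, exists_eq_right]

theorem negTranspose_negTranspose (X : A2) :
    negTranspose (Fin 3) ℂ (negTranspose (Fin 3) ℂ X) = X :=
  (negTranspose (Fin 3) ℂ).left_inv X

theorem negTranspose_innerAut (A : Matrix.SpecialLinearGroup (Fin 3) ℂ) (X : A2) :
    negTranspose (Fin 3) ℂ (innerAut A X) =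
      innerAut A⁻¹.transpose (negTranspose (Fin 3) ℂ X) := by
  have hA : (A⁻¹.transpose)⁻¹ = A.transpose := by
    rw [inv_eq_iff_mul_eq_one]
    ext1
    rw [Matrix.SpecialLinearGroup.coe_mul, Matrix.SpecialLinearGroup.coe_transpose,
      Matrix.SpecialLinearGroup.coe_transpose, ← Matrix.transpose_mul,
      ← Matrix.SpecialLinearGroup.coe_mul, mul_inv_cancel,
      Matrix.SpecialLinearGroup.coe_one, Matrix.transpose_one]
  ext1
  rw [innerAut_val, negTranspose_val, negTranspose_val, innerAut_val, hA]
  simp only [Matrix.transpose_mul, Matrix.SpecialLinearGroup.coe_transpose, mul_neg, neg_mul,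
    mul_assoc]

theorem Equivalent.of_map_negTranspose {L L' : LieSubalgebra ℂ A2}
    (h : Equivalent (L.map (negTranspose (Fin 3) ℂ).toLieHom) L') :
    Equivalent L (L'.map (negTranspose (Fin 3) ℂ).toLieHom) := by
  obtain ⟨A, rfl⟩ := h
  refine ⟨A⁻¹.transpose, LieSubalgebra.ext _ _ fun X ↦ ?_⟩
  simp only [LieSubalgebra.mem_map, LieEquiv.coe_toLieHom, exists_exists_and_eq_and,
    negTranspose_innerAut, negTranspose_negTranspose]

theorem Equivalent.finrank_eq {L L' : LieSubalgebra ℂ A2} (h : Equivalent L L') :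
    Module.finrank ℂ L = Module.finrank ℂ L' := by
  obtain ⟨A, rfl⟩ := h
  exact ((innerAut A).lieSubalgebraMap L).toLinearEquiv.finrank_eq

theorem Equivalent.hasInvariantLine {L L' : LieSubalgebra ℂ A2} (h : Equivalent L L')
    (hL' : HasInvariantLine L') : HasInvariantLine L := by
  obtain ⟨A, rfl⟩ := h
  obtain ⟨v, hv, hle⟩ := hL'
  refine ⟨A.val.mulVec v, ?_, fun X hX ↦ innerAut_mem_lineStabilizer.1 (hle ⟨X, hX, rfl⟩)⟩
  rwa [← Matrix.mulVec_zero A.val, (mulVec_injective A).ne_iff]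

theorem exists_mulVec_eq {v w : Fin 3 → ℂ} (hv : v ≠ 0) (hw : w ≠ 0) :
    ∃ (A : Matrix.SpecialLinearGroup (Fin 3) ℂ) (c : ℂˣ), A.val.mulVec w = c • v := by
  obtain ⟨A, hA⟩ := MulAction.exists_smul_eq (Matrix.SpecialLinearGroup (Fin 3) ℂ)
    (Projectivization.mk ℂ w hw) (Projectivization.mk ℂ v hv)
  rw [Projectivization.matrixSpecialLinearGroup_smul_def, Projectivization.smul_mk,
    Projectivization.mk_eq_mk_iff] at hA
  obtain ⟨c, hc⟩ := hA
  exact ⟨A, c, hc.symm⟩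

theorem HasInvariantLine.exists_map_le {L : LieSubalgebra ℂ A2} (h : HasInvariantLine L)
    {w : Fin 3 → ℂ} (hw : w ≠ 0) :
    ∃ A, L.map (innerAut A).toLieHom ≤ lineStabilizer ℂ A2 w := by
  obtain ⟨v, hv, hle⟩ := h
  obtain ⟨A, c, hA⟩ := exists_mulVec_eq hv hw
  refine ⟨A, ?_⟩
  rintro _ ⟨X, hX, rfl⟩
  obtain ⟨d, hd⟩ := hle hX
  refine innerAut_mem_lineStabilizer.2 ⟨d, ?_⟩
  rw [hA, Units.smul_def, lie_smul, hd, smul_comm]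

theorem lie_chevalley (a b c d e c' d' e' p q r s t r' s' t' : ℂ) :
    ⁅chevalley a b c d e c' d' e', chevalley p q r s t r' s' t'⁆ =
      chevalley (c * r' + e * t' - r * c' - t * e') (e * t' + d * s' - t * e' - s * d')
        (a * r + c * (q - p) - e * s' - p * c - r * (b - a) + t * d')
        (-c' * t + (b - a) * s - d * q + r' * e - (q - p) * d + s * b)
        (a * t - c * s - e * q - p * e + r * d + t * b)
        (c' * p + (b - a) * r' - d * t' - r' * a - (q - p) * c' + s * e')
        (-e' * r + d' * (q - p) - b * s' + t' * c - s' * (b - a) + q * d')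
        (e' * p - d' * r' - b * t' - t' * a + s' * c' + q * e') := by
  refine A2_ext fun i j ↦ ?_
  rw [lie_val_apply]
  fin_cases i <;> fin_cases j <;> simp [chevalley, Fin.sum_univ_succ] <;> ring

theorem h₁_add_h₂ : h₁ + h₂ = chevalley 1 1 0 0 0 0 0 0 := by simp [chevalley_eq 1 1]

theorem add_add_eq_chevalley (s t u : ℂ) :
    s • (h₁ - h₂) + t • x₂ + u • y₁ = chevalley s (-s) 0 t 0 u 0 0 := by
  rw [chevalley_eq]
  module

theorem lie_x₃_y₁ : ⁅x₃, y₁⁆ = x₂ := by simp [x₃, y₁, x₂, lie_chevalley]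

theorem lie_y₃_x₂ : ⁅y₃, x₂⁆ = y₁ := by simp [y₃, y₁, x₂, lie_chevalley]

theorem lie_x₃_y₃ : ⁅x₃, y₃⁆ = h₁ + h₂ := by simp [x₃, y₃, h₁_add_h₂, lie_chevalley]

theorem lie_h₁_add_h₂_x₃ : ⁅h₁ + h₂, x₃⁆ = (2 : ℂ) • x₃ := by
  rw [h₁_add_h₂, x₃, lie_chevalley, chevalley_eq, chevalley_eq 0 0 0 0 1]
  module

theorem lie_h₁_add_h₂_y₃ : ⁅h₁ + h₂, y₃⁆ = (-2 : ℂ) • y₃ := by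
  rw [h₁_add_h₂, y₃, lie_chevalley, chevalley_eq, chevalley_eq 0 0 0 0 0 0 0 1]
  module

theorem lie_h₁_add_h₂_h₁_sub_h₂ : ⁅h₁ + h₂, h₁ - h₂⁆ = 0 := by
  have h : h₁ - h₂ = chevalley 1 (-1) 0 0 0 0 0 0 := by simp [chevalley_eq 1 (-1), sub_eq_add_neg]
  rw [h₁_add_h₂, h, lie_chevalley, chevalley_eq]
  module

theorem lie_h₁_add_h₂_x₂ : ⁅h₁ + h₂, x₂⁆ = x₂ := by
  simp [h₁_add_h₂, x₂, lie_chevalley]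

theorem lie_h₁_add_h₂_y₁ : ⁅h₁ + h₂, y₁⁆ = -y₁ := by
  rw [h₁_add_h₂, y₁, lie_chevalley, chevalley_eq, chevalley_eq 0 0 0 0 0 1]
  module

/-- The maximal parabolic subalgebra of `A₂` stabilizing the line of the second basis vector. -/
abbrev parabolic : LieSubalgebra ℂ A2 := lineStabilizer ℂ A2 (Pi.single 1 1 : Fin 3 → ℂ)

theorem mem_parabolic {X : A2} : X ∈ parabolic ↔ X.val 0 1 = 0 ∧ X.val 2 1 = 0 := by
  rw [parabolic, mem_lineStabilizer]
  refine ⟨fun ⟨c, hc⟩ ↦ ⟨?_, ?_⟩, fun ⟨h0, h2⟩ ↦ ⟨X.val 1 1, ?_⟩⟩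
  · simpa [lie_apply_eq] using congrFun hc 0
  · simpa [lie_apply_eq] using congrFun hc 2
  · ext i
    fin_cases i <;> simp [h0, h2]

theorem A11_le_parabolic : A11 ≤ parabolic := by
  rw [← range_chiHom]
  rintro _ ⟨M, rfl⟩
  exact mem_parabolic.2 (by simp [chiHom, chi_val])

theorem eq_chi_blockPart_add {X : A2} (hX : X ∈ parabolic) :
    X = chi (blockPart X) +
      (-(X.val 1 1 / 2) • (h₁ - h₂) + X.val 1 2 • x₂ + X.val 1 0 • y₁) := by
  obtain ⟨h0, h2⟩ := mem_parabolic.1 hX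
  rw [add_add_eq_chevalley]
  refine A2_ext fun i j ↦ ?_
  fin_cases i <;> fin_cases j <;> simp [chi_val, blockPart_val, chevalley, h0, h2]
  all_goals linear_combination (1 / 2) * trace_A2 X

theorem chi_mem_A11 (M : A1) : chi M ∈ A11 := range_chiHom ▸ ⟨M, rfl⟩

theorem leviSubalgebra_four : leviSubalgebra 4 = parabolic := by
  refine le_antisymm (sup_le A11_le_parabolic (LieSubalgebra.lieSpan_le.2 ?_)) fun X hX ↦ ?_
  · rintro _ (rfl | rfl | rfl) <;> exact mem_parabolic.2 (by simp [h₁, h₂, x₂, y₁, chevalley])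
  · rw [eq_chi_blockPart_add hX]
    have hgen {Y : A2} (hY : Y ∈ ({h₁ - h₂, x₂, y₁} : Set A2)) : Y ∈ leviSubalgebra 4 :=
      le_sup_right (a := A11) (b := radicalPart 4) (subset_gen hY)
    have hA : chi (blockPart X) ∈ leviSubalgebra 4 :=
      le_sup_left (a := A11) (b := radicalPart 4) (chi_mem_A11 _)
    exact add_mem hA (add_mem (add_mem (LieSubalgebra.smul_mem _ _ (hgen (by simp)))
      (LieSubalgebra.smul_mem _ _ (hgen (by simp)))) (LieSubalgebra.smul_mem _ _ (hgen (by simp))))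

theorem IsLeviDecomposable.not_isIrreducible {L : LieSubalgebra ℂ A2}
    (h : IsLeviDecomposable L) : ¬ LieModule.IsIrreducible ℂ L (Fin 3 → ℂ) := fun _ ↦
  h.not_hasTrivialRadical <| hasTrivialRadical_of_isIrreducible_of_isFaithful ℂ L (Fin 3 → ℂ)
    fun X ↦ trace_toEnd_sl X.1

theorem negTranspose_lie_dotProduct (X : A2) (w u : Fin 3 → ℂ) :
    ⁅negTranspose (Fin 3) ℂ X, w⁆ ⬝ᵥ u = -(w ⬝ᵥ ⁅X, u⁆) := by
  rw [lie_apply_eq, lie_apply_eq, negTranspose_val, Matrix.neg_mulVec, neg_dotProduct,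
    Matrix.mulVec_transpose, Matrix.dotProduct_mulVec]

theorem hasInvariantLine_of_finrank_eq_one {L : LieSubalgebra ℂ A2}
    {N : LieSubmodule ℂ L (Fin 3 → ℂ)} (hN : Module.finrank ℂ N = 1) : HasInvariantLine L := by
  obtain ⟨⟨v, hvN⟩, hv0, hv⟩ := finrank_eq_one_iff'.1 hN
  refine ⟨v, fun h ↦ hv0 (Subtype.ext h), fun X hX ↦ ?_⟩
  obtain ⟨c, hc⟩ := hv ⟨_, N.lie_mem (x := ⟨X, hX⟩) hvN⟩
  exact ⟨c, (congrArg Subtype.val hc).symm⟩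

theorem hasInvariantLine_map_negTranspose_of_finrank_eq_two {L : LieSubalgebra ℂ A2}
    {N : LieSubmodule ℂ L (Fin 3 → ℂ)} (hN : Module.finrank ℂ N = 2) :
    HasInvariantLine (L.map (negTranspose (Fin 3) ℂ).toLieHom) := by
  have hann : Module.finrank ℂ N.toSubmodule.dualAnnihilator = 1 := by
    have hadd := Subspace.finrank_add_finrank_dualAnnihilator_eq N.toSubmodule
    rw [Module.finrank_fin_fun] at hadd
    have hN' : Module.finrank ℂ N.toSubmodule = 2 := hN
    lia
  obtain ⟨⟨f, hf⟩, hf0, hspan⟩ := finrank_eq_one_iff'.1 hann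
  obtain ⟨w, rfl⟩ := (dotProductEquiv ℂ (Fin 3)).surjective f
  refine ⟨w, ?_, ?_⟩
  · rintro rfl
    exact hf0 (Subtype.ext (map_zero _))
  rintro _ ⟨X, hX, rfl⟩
  have hmem : dotProductEquiv ℂ (Fin 3) ⁅negTranspose (Fin 3) ℂ X, w⁆ ∈
      N.toSubmodule.dualAnnihilator := by
    refine (Submodule.mem_dualAnnihilator _).2 fun u hu ↦ ?_
    have hXu := (Submodule.mem_dualAnnihilator _).1 hf _ (N.lie_mem (x := ⟨X, hX⟩) hu)
    rw [dotProductEquiv_apply_apply] at hXu ⊢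
    rw [negTranspose_lie_dotProduct, neg_eq_zero]
    exact hXu
  obtain ⟨c, hc⟩ := hspan ⟨_, hmem⟩
  refine ⟨c, (dotProductEquiv ℂ (Fin 3)).injective ?_⟩
  rw [map_smul]
  exact (congrArg Subtype.val hc).symm

theorem IsLeviDecomposable.hasInvariantLine_or {L : LieSubalgebra ℂ A2}
    (h : IsLeviDecomposable L) :
    HasInvariantLine L ∨ HasInvariantLine (L.map (negTranspose (Fin 3) ℂ).toLieHom) := by
  obtain ⟨N, hbot, htop⟩ : ∃ N : LieSubmodule ℂ L (Fin 3 → ℂ), N ≠ ⊥ ∧ N ≠ ⊤ := by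
    by_contra! hN
    exact h.not_isIrreducible (.mk hN)
  have hpos : Module.finrank ℂ N ≠ 0 :=
    fun h0 ↦ hbot (N.toSubmodule_eq_bot.1 (Submodule.finrank_eq_zero.1 h0))
  have hlt : Module.finrank ℂ N < 3 := by
    have hN : N.toSubmodule ≠ ⊤ := mt N.toSubmodule_eq_top.1 htop
    exact (Submodule.finrank_lt hN).trans_eq (Module.finrank_fin_fun ℂ)
  obtain h1 | h2 : Module.finrank ℂ N = 1 ∨ Module.finrank ℂ N = 2 := by lia
  · exact .inl (hasInvariantLine_of_finrank_eq_one h1)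
  · exact .inr (hasInvariantLine_map_negTranspose_of_finrank_eq_two h2)

theorem lie_eq_zero_of_mem_lineStabilizer {X : A2} {v : Fin 3 → ℂ}
    (hX : IsNilpotent X.val) (hv : X ∈ lineStabilizer ℂ A2 v) : ⁅X, v⁆ = 0 := by
  obtain ⟨c, hc⟩ := hv
  obtain ⟨n, hn⟩ := hX
  have hpow (k : ℕ) : (X.val ^ k).mulVec v = c ^ k • v := by
    induction k with
    | zero => simp
    | succ k ih =>
      rw [pow_succ, ← Matrix.mulVec_mulVec, ← lie_apply_eq, hc, Matrix.mulVec_smul, ih, smul_smul,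
        pow_succ']
  have h0 : c ^ n • v = 0 := by rw [← hpow, hn, Matrix.zero_mulVec]
  rcases smul_eq_zero.1 h0 with hc0 | hv0
  · rw [hc, eq_zero_of_pow_eq_zero hc0, zero_smul]
  · rw [hv0, lie_zero]

theorem chevalley_lie (a b c d e c' d' e' : ℂ) (v : Fin 3 → ℂ) :
    ⁅chevalley a b c d e c' d' e', v⁆ =
      ![a * v 0 + c * v 1 - e * v 2, c' * v 0 + (b - a) * v 1 + d * v 2,
        -e' * v 0 + d' * v 1 - b * v 2] := by
  ext i
  fin_cases i <;>
    simp [chevalley, Matrix.mulVec, dotProduct, Fin.sum_univ_three, sub_eq_add_neg]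

theorem isNilpotent_upper (c d e : ℂ) : IsNilpotent (chevalley 0 0 c d e 0 0 0).val :=
  ⟨3, by
    ext i j
    fin_cases i <;> fin_cases j <;>
      simp [chevalley, pow_succ, Matrix.mul_apply, Fin.sum_univ_three]⟩

theorem isNilpotent_lower (c d e : ℂ) : IsNilpotent (chevalley 0 0 0 0 0 c d e).val :=
  ⟨3, by
    ext i j
    fin_cases i <;> fin_cases j <;>
      simp [chevalley, pow_succ, Matrix.mul_apply, Fin.sum_univ_three]⟩

theorem not_hasInvariantLine_of_mem {L : LieSubalgebra ℂ A2} (hx₁ : x₁ ∈ L) (hx₃ : x₃ ∈ L)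
    (hy₃ : y₃ ∈ L) : ¬ HasInvariantLine L := by
  rintro ⟨v, hv, hL⟩
  have hv1 : ⁅x₁, v⁆ = 0 := lie_eq_zero_of_mem_lineStabilizer (isNilpotent_upper 1 0 0) (hL hx₁)
  have hv2 : ⁅x₃, v⁆ = 0 := lie_eq_zero_of_mem_lineStabilizer (isNilpotent_upper 0 0 1) (hL hx₃)
  have hv0 : ⁅y₃, v⁆ = 0 := lie_eq_zero_of_mem_lineStabilizer (isNilpotent_lower 0 0 1) (hL hy₃)
  rw [x₁, chevalley_lie] at hv1
  rw [x₃, chevalley_lie] at hv2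
  rw [y₃, chevalley_lie] at hv0
  refine hv (funext fun i ↦ ?_)
  fin_cases i
  · simpa using congrFun hv0 2
  · simpa using congrFun hv1 0
  · simpa using congrFun hv2 0

theorem x₁_add_x₂ : x₁ + x₂ = chevalley 0 0 1 1 0 0 0 0 := by simp [chevalley_eq 0 0 1 1]

theorem y₁_add_y₂ : y₁ + y₂ = chevalley 0 0 0 0 0 1 1 0 := by simp [chevalley_eq 0 0 0 0 0 1 1]

theorem not_hasInvariantLine_of_principal_mem {L : LieSubalgebra ℂ A2} (hx : x₁ + x₂ ∈ L)
    (hy : y₁ + y₂ ∈ L) : ¬ HasInvariantLine L := by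
  rintro ⟨v, hv, hL⟩
  rw [x₁_add_x₂] at hx
  rw [y₁_add_y₂] at hy
  have hxv := lie_eq_zero_of_mem_lineStabilizer (isNilpotent_upper 1 1 0) (hL hx)
  have hyv := lie_eq_zero_of_mem_lineStabilizer (isNilpotent_lower 1 1 0) (hL hy)
  rw [chevalley_lie] at hxv hyv
  refine hv (funext fun i ↦ ?_)
  fin_cases i
  · simpa using congrFun hyv 1
  · simpa using congrFun hxv 0
  · simpa using congrFun hxv 1

theorem not_isLeviDecomposable_of_A12_le {L : LieSubalgebra ℂ A2} (hL : A12 ≤ L) :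
    ¬ IsLeviDecomposable L := by
  have hx : x₁ + x₂ ∈ L := hL (subset_gen (by simp))
  have hy : y₁ + y₂ ∈ L := by
    have h2 : (2 : ℂ) • y₁ + (2 : ℂ) • y₂ ∈ L := hL (subset_gen (by simp))
    rw [← smul_add] at h2
    exact (L.toSubmodule.smul_mem_iff two_ne_zero).1 h2
  have hnx : negTranspose (Fin 3) ℂ (x₁ + x₂) = -(y₁ + y₂) := by
    rw [x₁_add_x₂, y₁_add_y₂, negTranspose_chevalley]
  have hny : negTranspose (Fin 3) ℂ (y₁ + y₂) = -(x₁ + x₂) := by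
    rw [x₁_add_x₂, y₁_add_y₂, negTranspose_chevalley]
  intro h
  refine h.hasInvariantLine_or.elim (not_hasInvariantLine_of_principal_mem hx hy)
    (not_hasInvariantLine_of_principal_mem ?_ ?_)
  · rw [← neg_neg (x₁ + x₂), ← hny]
    exact neg_mem ⟨_, hy, rfl⟩
  · rw [← neg_neg (y₁ + y₂), ← hnx]
    exact neg_mem ⟨_, hx, rfl⟩

theorem hasInvariantLine_leviSubalgebra_four : HasInvariantLine (leviSubalgebra 4) :=
  ⟨Pi.single 1 1, by simp, leviSubalgebra_four.le⟩

theorem leviSubalgebra_two_le_four : leviSubalgebra 2 ≤ leviSubalgebra 4 :=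
  sup_le_sup_left (LieSubalgebra.lieSpan_mono (Set.subset_insert _ _)) A11

theorem hasInvariantLine_leviSubalgebra_two : HasInvariantLine (leviSubalgebra 2) :=
  ⟨Pi.single 1 1, by simp, leviSubalgebra_two_le_four.trans leviSubalgebra_four.le⟩

theorem leviSubalgebra_one_le_three : leviSubalgebra 1 ≤ leviSubalgebra 3 :=
  sup_le_sup_left (LieSubalgebra.lieSpan_mono (Set.subset_insert _ _)) A11

theorem not_hasInvariantLine_leviSubalgebra_one : ¬ HasInvariantLine (leviSubalgebra 1) :=
  not_hasInvariantLine_of_mem (le_sup_right (a := A11) (b := radicalPart 1) (subset_gen (by simp)))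
    (le_sup_left (a := A11) (b := radicalPart 1) (subset_gen (by simp)))
    (le_sup_left (a := A11) (b := radicalPart 1) (subset_gen (by simp)))

theorem not_hasInvariantLine_leviSubalgebra_three : ¬ HasInvariantLine (leviSubalgebra 3) :=
  fun ⟨v, hv, hle⟩ ↦ not_hasInvariantLine_leviSubalgebra_one
    ⟨v, hv, leviSubalgebra_one_le_three.trans hle⟩

theorem eq_of_equivalent_leviSubalgebra {i j : Fin 5}
    (h : Equivalent (leviSubalgebra i) (leviSubalgebra j)) : i = j := by
  have hrank := h.finrank_eq
  rw [finrank_leviSubalgebra, finrank_leviSubalgebra] at hrank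
  have hline : HasInvariantLine (leviSubalgebra i) ↔ HasInvariantLine (leviSubalgebra j) :=
    ⟨h.symm.hasInvariantLine, h.hasInvariantLine⟩
  fin_cases i <;> fin_cases j <;>
    simp_all [hasInvariantLine_leviSubalgebra_two, not_hasInvariantLine_leviSubalgebra_one,
      hasInvariantLine_leviSubalgebra_four, not_hasInvariantLine_leviSubalgebra_three]

/-! ### Levi factors in the parabolic subalgebra -/

theorem lie_apply_one_one {X Y : A2} (hX : X ∈ parabolic) (hY : Y ∈ parabolic) :
    ⁅X, Y⁆.val 1 1 = 0 := by
  obtain ⟨hX0, hX2⟩ := mem_parabolic.1 hX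
  obtain ⟨hY0, hY2⟩ := mem_parabolic.1 hY
  rw [lie_val_apply, Fin.sum_univ_three, hX0, hX2, hY0, hY2]
  ring

theorem blockPart_lie {X Y : A2} (hX : X ∈ parabolic) (hY : Y ∈ parabolic) :
    blockPart ⁅X, Y⁆ = ⁅blockPart X, blockPart Y⁆ := by
  obtain ⟨hX0, hX2⟩ := mem_parabolic.1 hX
  obtain ⟨hY0, hY2⟩ := mem_parabolic.1 hY
  ext i j
  rw [sl_bracket]
  fin_cases i <;> fin_cases j <;>
    simp [blockPart_val, lie_val_apply, Fin.sum_univ_three, hX0, hX2, hY0, hY2] <;> ring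

/-- The quotient map onto `A₁` of the parabolic subalgebra modulo its radical, restricted to a
subalgebra `S`. -/
def blockHom {S : LieSubalgebra ℂ A2} (hS : S ≤ parabolic) : S →ₗ⁅ℂ⁆ A1 where
  toLinearMap := blockPart ∘ₗ S.subtype
  map_lie' {X Y} := blockPart_lie (hS X.2) (hS Y.2)

theorem exists_eq_of_blockPart_eq_zero {X : A2} (hX : X ∈ parabolic) (h0 : blockPart X = 0) :
    ∃ s t u : ℂ, X = s • (h₁ - h₂) + t • x₂ + u • y₁ := by
  have hchi : chi (blockPart X) = 0 := by
    rw [h0]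
    exact map_zero chiHom
  exact ⟨_, _, _, by rw [← zero_add (_ + _), ← hchi, ← eq_chi_blockPart_add hX]⟩

theorem isSolvable_ker_blockHom {S : LieSubalgebra ℂ A2} (hS : S ≤ parabolic) :
    IsSolvable (blockHom hS).ker := by
  refine isSolvable_of_lie_lie_lie_eq_zero (R := ℂ) fun X Y Z W ↦ ?_
  have hker (X : (blockHom hS).ker) : ∃ s t u : ℂ, X.1.1 = s • (h₁ - h₂) + t • x₂ + u • y₁ :=
    exists_eq_of_blockPart_eq_zero (hS X.1.2) X.2
  obtain ⟨s, t, u, hX⟩ := hker X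
  obtain ⟨s', t', u', hY⟩ := hker Y
  obtain ⟨p, q, r, hZ⟩ := hker Z
  obtain ⟨p', q', r', hW⟩ := hker W
  refine Subtype.ext (Subtype.ext ?_)
  change ⁅⁅X.1.1, Y.1.1⁆, ⁅Z.1.1, W.1.1⁆⁆ = 0
  simp only [hX, hY, hZ, hW, add_add_eq_chevalley, lie_chevalley]
  rw [chevalley_eq]
  module

theorem exists_section_blockPart {S : LieSubalgebra ℂ A2} (hS : S ≤ parabolic) [Nontrivial S]
    [HasTrivialRadical ℂ S] :
    ∃ σ : A1 →ₗ⁅ℂ⁆ A2, (∀ M, σ M ∈ S) ∧ ∀ M, blockPart (σ M) = M := by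
  have := isSolvable_ker_blockHom hS
  have hinj : Function.Injective (blockHom hS) := injective_of_isSolvable_ker _
  have hrank : Module.finrank ℂ S = Module.finrank ℂ A1 :=
    le_antisymm (LinearMap.finrank_le_finrank_of_injective (f := (blockHom hS).toLinearMap) hinj)
      (finrank_A1.trans_le (two_lt_finrank_of_hasTrivialRadical ℂ S))
  have hsurj : Function.Surjective (blockHom hS) :=
    (LinearMap.injective_iff_surjective_of_finrank_eq_finrank
      (f := (blockHom hS).toLinearMap) hrank).1 hinj
  let e := LieEquiv.ofBijective (blockHom hS) ⟨hinj, hsurj⟩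
  exact ⟨S.incl.comp e.symm.toLieHom, fun M ↦ (e.symm M).2, e.apply_symm_apply⟩

/-- The element of `SL(3, ℂ)` whose inner automorphism is `exp (ad (b x₂ - a y₁))`. -/
def unipotent (a b : ℂ) : Matrix.SpecialLinearGroup (Fin 3) ℂ :=
  ⟨!![1, 0, 0; a, 1, b; 0, 0, 1], by simp [Matrix.det_fin_three]⟩

theorem unipotent_inv (a b : ℂ) : (unipotent a b)⁻¹ = unipotent (-a) (-b) := by
  rw [inv_eq_iff_mul_eq_one]
  ext i j
  rw [Matrix.SpecialLinearGroup.coe_mul]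
  fin_cases i <;> fin_cases j <;> simp [unipotent]

theorem innerAut_unipotent_val (a b : ℂ) (X : A2) :
    (innerAut (unipotent a b) X).val =
      !![1, 0, 0; -a, 1, -b; 0, 0, 1] * X.val * !![1, 0, 0; a, 1, b; 0, 0, 1] := by
  rw [innerAut_val, unipotent_inv]
  rfl

theorem innerAut_unipotent_mem_parabolic {X : A2} (a b : ℂ) (hX : X ∈ parabolic) :
    innerAut (unipotent a b) X ∈ parabolic := by
  rw [parabolic, innerAut_mem_lineStabilizer]
  convert hX
  ext i
  fin_cases i <;> simp [unipotent]

theorem blockPart_innerAut_unipotent {X : A2} (a b : ℂ) (hX : X ∈ parabolic) :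
    blockPart (innerAut (unipotent a b) X) = blockPart X := by
  obtain ⟨h0, h2⟩ := mem_parabolic.1 hX
  ext i j
  fin_cases i <;> fin_cases j <;>
    simp [blockPart_val, innerAut_unipotent_val, Matrix.mul_apply, Matrix.vecMul, dotProduct,
      Fin.sum_univ_three, h0, h2]

theorem innerAut_unipotent_chi_add (t u : ℂ) :
    innerAut (unipotent u (-t)) (h₁ + h₂ + (t • x₂ + u • y₁)) = h₁ + h₂ := by
  refine A2_ext fun i j ↦ ?_
  fin_cases i <;> fin_cases j <;>
    simp [innerAut_unipotent_val, Matrix.mul_apply, Fin.sum_univ_three, h₁, h₂, x₂,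
      y₁, chevalley]

theorem eq_zero_of_lie_h₁_add_h₂ {X : A2} {c : ℂ} (hX : X ∈ parabolic) (h0 : blockPart X = 0)
    (hlie : ⁅h₁ + h₂, X⁆ = c • X) (hc : c ^ 3 ≠ c) : X = 0 := by
  have hcube : ⁅h₁ + h₂, ⁅h₁ + h₂, ⁅h₁ + h₂, X⁆⁆⁆ = ⁅h₁ + h₂, X⁆ := by
    obtain ⟨s, t, u, rfl⟩ := exists_eq_of_blockPart_eq_zero hX h0
    simp only [lie_add, lie_smul, lie_neg, lie_h₁_add_h₂_h₁_sub_h₂, lie_h₁_add_h₂_x₂,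
      lie_h₁_add_h₂_y₁, smul_zero, zero_add, neg_neg]
  have hsmul : (c ^ 3 - c) • X = 0 := by
    rw [hlie, lie_smul, hlie, lie_smul, lie_smul, hlie] at hcube
    rw [sub_smul, ← hcube]
    module
  exact (smul_eq_zero.1 hsmul).resolve_left (sub_ne_zero.2 hc)

theorem section_blockPart_eq {σ : A1 →ₗ⁅ℂ⁆ A2} (hmem : ∀ M, σ M ∈ parabolic)
    (hσ : ∀ M, blockPart (σ M) = M) (hh : σ (blockPart (h₁ + h₂)) = h₁ + h₂) {X : A2} {c : ℂ}
    (hX : X ∈ parabolic) (hlie : ⁅h₁ + h₂, X⁆ = c • X) (hc : c ^ 3 ≠ c) :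
    σ (blockPart X) = X := by
  have hh' : h₁ + h₂ ∈ parabolic := hh ▸ hmem _
  rw [← sub_eq_zero]
  refine eq_zero_of_lie_h₁_add_h₂ (sub_mem (hmem _) hX) (by rw [map_sub, hσ, sub_self]) ?_ hc
  calc ⁅h₁ + h₂, σ (blockPart X) - X⁆ = σ (blockPart ⁅h₁ + h₂, X⁆) - ⁅h₁ + h₂, X⁆ := by
        rw [lie_sub, blockPart_lie hh' hX, LieHom.map_lie, hh]
    _ = c • (σ (blockPart X) - X) := by
        rw [hlie, map_smul, map_smul, smul_sub]

theorem chi_blockPart_of_mem_A11 {X : A2} (hX : X ∈ A11) : chi (blockPart X) = X := by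
  rw [← range_chiHom] at hX
  obtain ⟨M, rfl⟩ := hX
  exact congrArg chi (blockPart_chi M)

theorem exists_section_blockPart_eq {σ : A1 →ₗ⁅ℂ⁆ A2} (hmem : ∀ M, σ M ∈ parabolic)
    (hσ : ∀ M, blockPart (σ M) = M) :
    ∃ t u : ℂ, σ (blockPart (h₁ + h₂)) = h₁ + h₂ + (t • x₂ + u • y₁) := by
  have hx₃ : x₃ ∈ parabolic := A11_le_parabolic (subset_gen (by simp))
  have hy₃ : y₃ ∈ parabolic := A11_le_parabolic (subset_gen (by simp))
  have hchi : chi (blockPart (h₁ + h₂)) = h₁ + h₂ :=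
    chi_blockPart_of_mem_A11 (subset_gen (by simp))
  have h11 : (σ (blockPart (h₁ + h₂))).val 1 1 = 0 := by
    rw [← lie_x₃_y₃, blockPart_lie hx₃ hy₃, LieHom.map_lie]
    exact lie_apply_one_one (hmem _) (hmem _)
  have hdec := eq_chi_blockPart_add (hmem (blockPart (h₁ + h₂)))
  rw [h11, hσ, hchi, zero_div, neg_zero, zero_smul, zero_add] at hdec
  exact ⟨_, _, hdec⟩

theorem exists_A11_le_map {S : LieSubalgebra ℂ A2} (hS : S ≤ parabolic) [Nontrivial S]
    [HasTrivialRadical ℂ S] :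
    ∃ t u : ℂ, A11 ≤ S.map (innerAut (unipotent t u)).toLieHom := by
  obtain ⟨σ, hσS, hσ⟩ := exists_section_blockPart hS
  have hmem (M) : σ M ∈ parabolic := hS (hσS M)
  have hx₃ : x₃ ∈ parabolic := A11_le_parabolic (subset_gen (by simp))
  have hy₃ : y₃ ∈ parabolic := A11_le_parabolic (subset_gen (by simp))
  obtain ⟨t, u, hh⟩ := exists_section_blockPart_eq hmem hσ
  refine ⟨u, -t, LieSubalgebra.lieSpan_le.2 ?_⟩
  let τ : A1 →ₗ⁅ℂ⁆ A2 := (innerAut (unipotent u (-t))).toLieHom.comp σ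
  have hτS (M) : τ M ∈ S.map (innerAut (unipotent u (-t))).toLieHom := ⟨_, hσS M, rfl⟩
  have hτmem (M) : τ M ∈ parabolic := innerAut_unipotent_mem_parabolic _ _ (hmem M)
  have hτ (M) : blockPart (τ M) = M := (blockPart_innerAut_unipotent _ _ (hmem M)).trans (hσ M)
  have hτh : τ (blockPart (h₁ + h₂)) = h₁ + h₂ :=
    (congrArg _ hh).trans (innerAut_unipotent_chi_add t u)
  rintro _ (rfl | rfl | rfl)
  · rw [← section_blockPart_eq hτmem hτ hτh hx₃ lie_h₁_add_h₂_x₃ (by norm_num)]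
    exact hτS _
  · rw [← section_blockPart_eq hτmem hτ hτh hy₃ lie_h₁_add_h₂_y₃ (by norm_num)]
    exact hτS _
  · rw [← hτh]
    exact hτS _

theorem smul_mem_of_add_mem {L : LieSubalgebra ℂ A2} (hA : A11 ≤ L) {s t u : ℂ}
    (h : s • (h₁ - h₂) + t • x₂ + u • y₁ ∈ L) :
    s • (h₁ - h₂) ∈ L ∧ t • x₂ ∈ L ∧ u • y₁ ∈ L := by
  have hh : h₁ + h₂ ∈ L := hA (subset_gen (by simp))
  have hdiff : t • x₂ - u • y₁ ∈ L := by
    convert L.lie_mem hh h using 1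
    simp only [lie_add, lie_smul, lie_h₁_add_h₂_h₁_sub_h₂, lie_h₁_add_h₂_x₂, lie_h₁_add_h₂_y₁]
    module
  have hsum : t • x₂ + u • y₁ ∈ L := by
    convert L.lie_mem hh hdiff using 1
    simp only [lie_sub, lie_smul, lie_h₁_add_h₂_x₂, lie_h₁_add_h₂_y₁]
    module
  refine ⟨?_, ?_, ?_⟩
  · convert sub_mem h hsum using 1
    module
  · convert L.smul_mem (1 / 2) (add_mem hsum hdiff) using 1
    module
  · convert L.smul_mem (1 / 2) (sub_mem hsum hdiff) using 1
    module

theorem x₂_mem_iff_y₁_mem {L : LieSubalgebra ℂ A2} (hA : A11 ≤ L) : x₂ ∈ L ↔ y₁ ∈ L :=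
  ⟨fun h ↦ lie_y₃_x₂ ▸ L.lie_mem (hA (subset_gen (by simp))) h,
    fun h ↦ lie_x₃_y₁ ▸ L.lie_mem (hA (subset_gen (by simp))) h⟩

theorem le_of_A11_le {L M : LieSubalgebra ℂ A2} (hA : A11 ≤ L) (hL : L ≤ parabolic) (hM : A11 ≤ M)
    (hh : h₁ - h₂ ∈ L → h₁ - h₂ ∈ M) (hx : x₂ ∈ L → x₂ ∈ M) : L ≤ M := by
  intro X hX
  have hchi : chi (blockPart X) ∈ A11 := chi_mem_A11 _
  have hdec := eq_chi_blockPart_add (hL hX)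
  obtain ⟨hs, ht, hu⟩ := smul_mem_of_add_mem hA (eq_sub_of_add_eq' hdec.symm ▸ sub_mem hX (hA hchi))
  have hsmul {c : ℂ} {Y : A2} (hc : c • Y ∈ L) (hY : Y ∈ L → Y ∈ M) : c • Y ∈ M := by
    rcases eq_or_ne c 0 with rfl | hc0
    · simp
    · exact M.smul_mem c (hY ((L.toSubmodule.smul_mem_iff hc0).1 hc))
  rw [hdec]
  refine add_mem (hM hchi) (add_mem (add_mem (hsmul hs hh) (hsmul ht hx)) (hsmul hu fun hy ↦ ?_))
  exact (x₂_mem_iff_y₁_mem hM).1 (hx ((x₂_mem_iff_y₁_mem hA).2 hy))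

theorem eq_leviSubalgebra_of_A11_le {L : LieSubalgebra ℂ A2} (hA : A11 ≤ L)
    (hL : L ≤ parabolic) (hne : L ≠ A11) : ∃ i, L = leviSubalgebra i := by
  have hle {i : Fin 5} {W : Set A2} (hi : radicalPart i = gen W) (hW : W ⊆ L) :
      leviSubalgebra i ≤ L := sup_le hA (hi.trans_le (LieSubalgebra.lieSpan_le.2 hW))
  have hmem {i : Fin 5} {W : Set A2} (hi : radicalPart i = gen W) {Y : A2} (hY : Y ∈ W) :
      Y ∈ leviSubalgebra i := le_sup_right (a := A11) (hi ▸ subset_gen hY)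
  by_cases hh : h₁ - h₂ ∈ L <;> by_cases hx : x₂ ∈ L
  · refine ⟨4, le_antisymm (hL.trans_eq leviSubalgebra_four.symm) (hle rfl ?_)⟩
    rintro _ (rfl | rfl | rfl)
    exacts [hh, hx, (x₂_mem_iff_y₁_mem hA).1 hx]
  · exact ⟨0, le_antisymm (le_of_A11_le hA hL le_sup_left (fun _ ↦ hmem (i := 0) rfl rfl)
      fun h ↦ (hx h).elim) (hle rfl (Set.singleton_subset_iff.2 hh))⟩
  · refine ⟨2, le_antisymm (le_of_A11_le hA hL le_sup_left (fun h ↦ (hh h).elim)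
      fun _ ↦ hmem (i := 2) rfl (by simp)) (hle rfl ?_)⟩
    rintro _ (rfl | rfl)
    exacts [hx, (x₂_mem_iff_y₁_mem hA).1 hx]
  · exact (hne (le_antisymm (le_of_A11_le hA hL le_rfl (fun h ↦ (hh h).elim)
      fun h ↦ (hx h).elim) hA)).elim

theorem not_isLeviDecomposable_A11 : ¬ IsLeviDecomposable A11 := by
  rw [← range_chiHom]
  have : IsSemisimple ℂ chiHom.range :=
    isSemisimple_of_equiv (LieEquiv.ofInjective chiHom chiHom_injective)
  exact fun h ↦ h.not_hasTrivialRadical inferInstance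

theorem exists_equivalent_of_hasInvariantLine {L : LieSubalgebra ℂ A2} (h : IsLeviDecomposable L)
    (hL : HasInvariantLine L) : ∃ i, Equivalent L (leviSubalgebra i) := by
  obtain ⟨A, hA⟩ := hL.exists_map_le (w := Pi.single 1 1) (by simp)
  have hLA := h.map (innerAut A)
  obtain ⟨S, R, hS, -, hss, -, hSR⟩ := id hLA
  have hSL : S ≤ L.map (innerAut A).toLieHom :=
    (LieSubalgebra.toSubmodule_le_toSubmodule _ _).1 (hSR.sup_eq ▸ le_sup_left)
  have : Nontrivial S :=
    (Submodule.nontrivial_iff_ne_bot (p := S.toSubmodule)).2 (by simpa using hS)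
  obtain ⟨t, u, hA11⟩ := exists_A11_le_map (hSL.trans hA)
  let B := unipotent t u
  let L' := (L.map (innerAut A).toLieHom).map (innerAut B).toLieHom
  have hL' : L' ≤ parabolic := by
    rintro _ ⟨X, hX, rfl⟩
    exact innerAut_unipotent_mem_parabolic t u (hA hX)
  have hne : L' ≠ A11 := fun heq ↦ not_isLeviDecomposable_A11 (heq ▸ hLA.map (innerAut B))
  have hAL' : A11 ≤ L' :=
    hA11.trans (LieSubalgebra.map_le_iff_le_comap.2 fun X hX ↦ ⟨X, hSL hX, rfl⟩)
  obtain ⟨i, hi⟩ := eq_leviSubalgebra_of_A11_le hAL' hL' hne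
  exact ⟨i, Equivalent.trans ⟨A, rfl⟩ ⟨B, hi⟩⟩

theorem exists_equivalent_leviSubalgebra {L : LieSubalgebra ℂ A2} (h : IsLeviDecomposable L) :
    ∃ i, Equivalent L (leviSubalgebra i) := by
  rcases h.hasInvariantLine_or with hL | hL
  · exact exists_equivalent_of_hasInvariantLine h hL
  · obtain ⟨i, hi⟩ := exists_equivalent_of_hasInvariantLine (h.map _) hL
    exact ⟨dualIndex i, map_negTranspose_leviSubalgebra i ▸ hi.of_map_negTranspose⟩

end LeviA2

end

theorem mainTheorem1 :
    (∀ i, IsLeviDecomposable (leviSubalgebra i)) ∧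
    (∀ L : LieSubalgebra ℂ A2, IsLeviDecomposable L → ∃ i, Equivalent L (leviSubalgebra i)) ∧
    (∀ i j, Equivalent (leviSubalgebra i) (leviSubalgebra j) → i = j) ∧
    IsDirectSum A11 (gen {h₁ - h₂}) (leviSubalgebra 0) ∧
    IsSemidirectSum A11 (gen {x₁, y₂}) (leviSubalgebra 1) ∧
    IsSemidirectSum A11 (gen {x₂, y₁}) (leviSubalgebra 2) ∧
    IsSemidirectSum A11 (gen {h₁ - h₂, x₁, y₂}) (leviSubalgebra 3) ∧
    IsSemidirectSum A11 (gen {h₁ - h₂, x₂, y₁}) (leviSubalgebra 4) ∧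
    Nonempty (leviSubalgebra 0 ≃ₗ⁅ℂ⁆ A1 × J) ∧
    Nonempty (leviSubalgebra 0 ≃ₗ⁅ℂ⁆ Matrix (Fin 2) (Fin 2) ℂ) ∧
    Nonempty (leviSubalgebra 1 ≃ₗ⁅ℂ⁆ (K1 ⋊⁅phi1⁆ A1)) ∧
    Nonempty (leviSubalgebra 2 ≃ₗ⁅ℂ⁆ (K1 ⋊⁅phi1⁆ A1)) ∧
    Nonempty (leviSubalgebra 3 ≃ₗ⁅ℂ⁆ (L2 ⋊⁅phi2⁆ A1)) ∧
    Nonempty (leviSubalgebra 4 ≃ₗ⁅ℂ⁆ (L2 ⋊⁅phi2⁆ A1)) ∧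
    Module.finrank ℂ (leviSubalgebra 1) = 5 ∧ Module.finrank ℂ (leviSubalgebra 2) = 5 ∧
    Module.finrank ℂ (leviSubalgebra 3) = 6 ∧ Module.finrank ℂ (leviSubalgebra 4) = 6 ∧
    (∀ L : LieSubalgebra ℂ A2, A12 ≤ L → ¬ IsLeviDecomposable L) := by
  have hdirect := isDirectSum_leviSubalgebra_zero
  have hsemi := isSemidirectSum_leviSubalgebra
  have hrank := finrank_leviSubalgebra
  exact ⟨isLeviDecomposable_leviSubalgebra, fun _ h ↦ exists_equivalent_leviSubalgebra h,
    fun _ _ ↦ eq_of_equivalent_leviSubalgebra, hdirect, hsemi 1, hsemi 2, hsemi 3, hsemi 4,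
    ⟨leviSubalgebraZeroEquiv⟩, ⟨leviSubalgebraZeroEquiv.trans prodJEquivMatrix⟩,
    ⟨leviSubalgebraOneEquiv⟩, ⟨(leviSubalgebraDualEquiv 1).trans leviSubalgebraOneEquiv⟩,
    ⟨leviSubalgebraThreeEquiv⟩, ⟨(leviSubalgebraDualEquiv 3).trans leviSubalgebraThreeEquiv⟩,
    hrank 1, hrank 2, hrank 3, hrank 4, fun _ hL ↦ not_isLeviDecomposable_of_A12_le hL⟩
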